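/- Let $1<r\le 2$ and let $(\mathbb B,\|\cdot\|)$ be a separable (real) Banach space which is $r$-smooth, i.e. there is an equivalent norm $\|\cdot\|'$ on $\mathbb B$ such that $$\sup_{t>0}\ \sup_{\|x\|'=\|y\|'=1}\frac{\|x+ty\|'+\|x-ty\|'-2}{t^r}<\infty .$$ Let $1<p<r$. Then there is a constant $K=K(p,\mathbb B)\in(0,\infty)$, depending only on $p$ and $\mathbb B$, such that the following holds. Let $m\ge 2$ be an integer, let $(\xi_i)_{i\ge1}$ be an i.i.d. sequence, defined on a probability space, with values in a measurable space $(S,\mathcal S)$, and let $h\colon S^m\to\mathbb B$ be a measurable function such that $h(\xi_1,\dots,\xi_m)$ is integrable and, for every $\ell_0\in\{1,\dots,m\}$, $$\mathbb E\big[h(\xi_1,\dots,\xi_m)\,\big|\,(\xi_j)_{1\le j\le m,\ j\ne \ell_0}\big]=0\quad\text{a.s.}$$ For $n\ge m$ put $U_{m,n}(h)=\sum_{1\le i_1<\dots<i_m\le n}h(\xi_{i_1},\dots,\xi_{i_m})$. Then $$\sup_{t>0}t^p\,\mathbb P\Big(\sup_{n\ge m}\frac1{n^{m/p}}\|U_{m,n}(h)\|>t\Big)\le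 K\,\mathbb E\big[\|h(\xi_1,\dots,\xi_m)\|^p\big]$$ (where the right-hand side may be $+\infty$). Moreover, if $\mathbb E\big[\|h(\xi_1,\dots,\xi_m)\|^p\big]<\infty$, then $$\lim_{n\to\infty}\frac1{n^{m/p}}\|U_{m,n}(h)\|=0\quad\text{almost surely.}$$ -/

import Mathlib

open MeasureTheory ProbabilityTheory Filter Topology

/-- `B` is `r`-smooth: there is an equivalent norm `N` on `B` with
`sup_{t > 0} sup_{N x = N y = 1} (N (x + t y) + N (x - t y) - 2) / t ^ r < ∞`. -/
def IsRSmooth (B : Type*) [NormedAddCommGroup B] [NormedSpace ℝ B] (r : ℝ) : Prop :=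
  ∃ N : Seminorm ℝ B,
    (∃ c C : ℝ, 0 < c ∧ 0 < C ∧ ∀ x : B, c * ‖x‖ ≤ N x ∧ N x ≤ C * ‖x‖) ∧
    ∃ M : ℝ, ∀ t : ℝ, 0 < t → ∀ x y : B, N x = 1 → N y = 1 →
      (N (x + t • y) + N (x - t • y) - 2) / t ^ r ≤ M

/-- An i.i.d. sequence of `S`-valued random variables. -/
structure IsIIDSequence {Ω S : Type*} [MeasurableSpace Ω] [MeasurableSpace S]
    (ξ : ℕ → Ω → S) (μ : Measure Ω) : Prop where
  measurable : ∀ i, Measurable (ξ i)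
  indep : iIndepFun ξ μ
  identDistrib : ∀ i, IdentDistrib (ξ i) (ξ 0) μ μ

/-- The strictly increasing `m`-tuples with entries among the first `n` indices. Sequences are
numbered from `0`, so these indices are `0, …, n - 1`. -/
def incTuples (m n : ℕ) : Finset (Fin m → ℕ) :=
  (Fintype.piFinset fun _ : Fin m => Finset.range n).filter
    fun i => ∀ a b : Fin m, a < b → i a < i b

/-- The `U`-statistic of order `m` with kernel `h` based on the first `n` terms of `ξ`. -/
def uStat {Ω S B : Type*} [AddCommMonoid B] {m : ℕ} (h : (Fin m → S) → B)
    (ξ : ℕ → Ω → S) (n : ℕ) (ω : Ω) : B :=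
  ∑ i ∈ incTuples m n, h fun l => ξ (i l) ω

/-- The random variable `h(ξ_1, …, ξ_m)` (the first `m` terms of the sequence). -/
def kernelRV {Ω S B : Type*} {m : ℕ} (h : (Fin m → S) → B) (ξ : ℕ → Ω → S) (ω : Ω) : B :=
  h fun l => ξ l ω

/-- The σ-algebra generated by the first `m` terms of `ξ`, with the term of index `l₀` removed. -/
abbrev sigmaWithout {Ω S : Type*} [MeasurableSpace S] {m : ℕ} (ξ : ℕ → Ω → S) (l₀ : Fin m) :
    MeasurableSpace Ω :=
  MeasurableSpace.comap (fun ω (l : {l : Fin m // l ≠ l₀}) => ξ (l : Fin m) ω)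
    MeasurableSpace.pi

/-- The kernel `h` is degenerated with respect to `ξ`: the random variable `h(ξ_1, …, ξ_m)` is
integrable, and its conditional expectation given all but any one of `ξ_1, …, ξ_m` vanishes.
(Integrability is what makes the conditional expectation meaningful.) -/
def IsDegenerated {Ω S B : Type*} [MeasurableSpace Ω] [MeasurableSpace S]
    [NormedAddCommGroup B] [NormedSpace ℝ B] [CompleteSpace B] {m : ℕ}
    (h : (Fin m → S) → B) (ξ : ℕ → Ω → S) (μ : Measure Ω) : Prop :=
  Integrable (kernelRV h ξ) μ ∧
    ∀ l₀ : Fin m, μ[kernelRV h ξ | sigmaWithout ξ l₀] =ᵐ[μ] 0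

/-
Smoothness of the norm gives a two-point inequality for an equivalent convex gauge `φ` comparable
to `‖·‖ ^ r`. Together with the conditional Jensen inequality, it bounds `E φ` of a sum of terms
indexed by finite sets of coordinates, each centred given all the variables but one in its index
set, by the sum of the `E φ`'s times a power of a constant. Since `n ↦ U_n(g)` is a martingale for
a canonical kernel `g`, Doob's inequality makes this bound maximal in `n`.

On the dyadic block `n ≤ 2 ^ (k + 1)`, the kernel `h` is truncated at the level
`c_k = c 2 ^ (k m / p)` and recentred by the Hoeffding projection; the truncated part is estimated
in `L ^ r` and the remainder in `L ^ 1`. As `p` lies strictly between `1` and `r`, the block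
probabilities sum to at most a constant times `c ^ (-p) E ‖h‖ ^ p`. This single estimate yields the
weak-type inequality by the union bound over the blocks and the almost sure convergence by the
Borel–Cantelli lemma. The constant does not depend on `m`, because `(2 ^ (k + 1)).choose m` is at
most `2 ^ ((k + 1) m) / m !` and the factorial absorbs every factor exponential in `m`.
-/

lemma rpow_one_add_le_quadratic {a r : ℝ} (ha : -1 ≤ a) (hr₁ : 1 ≤ r) (hr₂ : r ≤ 2) :
    (1 + a) ^ r ≤ 1 + r * a + a ^ 2 := by
  have ha0 : 0 ≤ 1 + a := by linarith
  have h := rpow_one_add_le_one_add_mul_self ha (p := r - 1) (by linarith) (by linarith)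
  calc (1 + a) ^ r = (1 + a) ^ (r - 1) * (1 + a) := by
        rw [← Real.rpow_add_one' ha0 (by linarith), sub_add_cancel]
    _ ≤ (1 + (r - 1) * a) * (1 + a) := by gcongr
    _ ≤ 1 + r * a + a ^ 2 := by nlinarith [sq_nonneg a]

section TwoPointSmoothness

variable {B : Type*} [AddCommGroup B] [Module ℝ B]

lemma convexOn_seminorm_rpow (N : Seminorm ℝ B) {r : ℝ} (hr : 1 ≤ r) :
    ConvexOn ℝ Set.univ fun x => N x ^ r := by
  refine ⟨convex_univ, fun x _ y _ a b ha hb hab => ?_⟩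
  have hN : N (a • x + b • y) ≤ a * N x + b * N y := by
    simpa using N.convexOn.2 (Set.mem_univ x) (Set.mem_univ y) ha hb hab
  calc N (a • x + b • y) ^ r ≤ (a * N x + b * N y) ^ r :=
        Real.rpow_le_rpow (apply_nonneg _ _) hN (by linarith)
    _ ≤ a • N x ^ r + b • N y ^ r :=
        (convexOn_rpow hr).2 (apply_nonneg N x) (apply_nonneg N y) ha hb hab

variable {N : Seminorm ℝ B} {r M : ℝ}

lemma seminorm_rpow_add_rpow_le_of_eq_one (hr₁ : 1 ≤ r) (hr₂ : r ≤ 2)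
    (hN : ∀ t : ℝ, 0 < t → ∀ x y : B, N x = 1 → N y = 1 →
      (N (x + t • y) + N (x - t • y) - 2) / t ^ r ≤ M) {x y : B} (hx : N x = 1) (hy : N y ≤ 1) :
    N (x + y) ^ r + N (x - y) ^ r ≤ 2 + (2 * M + 2) * N y ^ r := by
  have hadd : N (x + y) ≤ 1 + N y := hx ▸ map_add_le_add N x y
  have hsub : N (x - y) ≤ 1 + N y := hx ▸ map_sub_le_add N x y
  rcases (apply_nonneg N y).eq_or_lt' with hy0 | hy0
  · have hle : ∀ z, N z ≤ 1 + N y → N z ^ r ≤ 1 := fun z hz =>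
      Real.rpow_le_one (apply_nonneg N z) (by linarith) (by linarith)
    rw [hy0, Real.zero_rpow (by linarith)]
    linarith [hle _ hadd, hle _ hsub]
  have hsmooth : N (x + y) + N (x - y) - 2 ≤ M * N y ^ r := by
    have h := hN (N y) hy0 x ((N y)⁻¹ • y) hx
      (by rw [map_smul_eq_mul, Real.norm_of_nonneg (by positivity), inv_mul_cancel₀ hy0.ne'])
    rwa [smul_inv_smul₀ hy0.ne', div_le_iff₀ (by positivity)] at h
  have hsq : N y ^ 2 ≤ N y ^ r := by
    rw [← Real.rpow_two]
    exact Real.rpow_le_rpow_of_exponent_ge hy0 hy hr₂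
  have hquad : ∀ z, 1 ≤ N z + N y → N z ≤ 1 + N y → N z ^ r ≤ 1 + r * (N z - 1) + N y ^ r := by
    intro z h₁ h₂
    have h := rpow_one_add_le_quadratic (a := N z - 1) (by linarith) hr₁ hr₂
    rw [add_sub_cancel] at h
    nlinarith
  have hadd' : 1 ≤ N (x + y) + N y := by simpa [hx] using map_sub_le_add N (x + y) y
  have hsub' : 1 ≤ N (x - y) + N y := by simpa [hx] using map_add_le_add N (x - y) y
  have hmid : 2 ≤ N (x + y) + N (x - y) :=
    calc 2 = N ((2 : ℝ) • x) := by rw [map_smul_eq_mul, hx]; norm_num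
      _ = N (x + y + (x - y)) := by rw [two_smul]; congr 1; abel
      _ ≤ N (x + y) + N (x - y) := map_add_le_add N _ _
  nlinarith [hquad _ hadd' hadd, hquad _ hsub' hsub]

lemma seminorm_rpow_add_rpow_le (hr₁ : 1 ≤ r) (hr₂ : r ≤ 2) (hM : 0 ≤ M)
    (hN : ∀ t : ℝ, 0 < t → ∀ x y : B, N x = 1 → N y = 1 →
      (N (x + t • y) + N (x - t • y) - 2) / t ^ r ≤ M) (x y : B) :
    N (x + y) ^ r + N (x - y) ^ r ≤ 2 * N x ^ r + (2 * 2 ^ r + 2 * M + 2) * N y ^ r := by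
  have hxr := Real.rpow_nonneg (apply_nonneg N x) r
  have hyr := Real.rpow_nonneg (apply_nonneg N y) r
  have h2r : (0 : ℝ) ≤ 2 ^ r := by positivity
  rcases le_or_gt (N x) (N y) with hxy | hxy
  · have hle : ∀ z, N z ≤ N x + N y → N z ^ r ≤ 2 ^ r * N y ^ r := fun z hz => by
      rw [← Real.mul_rpow two_pos.le (apply_nonneg N y)]
      exact Real.rpow_le_rpow (apply_nonneg N z) (by linarith) (by linarith)
    nlinarith [hle _ (map_add_le_add N x y), hle _ (map_sub_le_add N x y)]
  · have hx : 0 < N x := (apply_nonneg N y).trans_lt hxy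
    have hscale : ∀ z, N ((N x)⁻¹ • z) = (N x)⁻¹ * N z := fun z => by
      rw [map_smul_eq_mul, Real.norm_of_nonneg (by positivity)]
    have h := seminorm_rpow_add_rpow_le_of_eq_one (x := (N x)⁻¹ • x) (y := (N x)⁻¹ • y)
      hr₁ hr₂ hN (by rw [hscale, inv_mul_cancel₀ hx.ne'])
      (by rw [hscale, inv_mul_le_one₀ hx]; exact hxy.le)
    simp only [← smul_add, ← smul_sub, hscale, Real.mul_rpow (inv_nonneg.2 hx.le)
      (apply_nonneg N _), Real.inv_rpow hx.le] at h
    have hρ : 0 < N x ^ r := by positivity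
    field_simp at h
    nlinarith [mul_nonneg h2r hyr]

end TwoPointSmoothness

/-- A substitute for `‖·‖ ^ r` that is convex and satisfies the two-point inequality of
`r`-smoothness with constant `κ`. In an `r`-smooth space the `r`-th power of a multiple of the
equivalent norm is one. -/
structure IsSmoothGauge {B : Type*} [NormedAddCommGroup B] [NormedSpace ℝ B]
    (φ : B → ℝ) (r κ C : ℝ) : Prop where
  one_le : 1 ≤ r
  κ_nonneg : 0 ≤ κ
  C_nonneg : 0 ≤ C
  convexOn : ConvexOn ℝ Set.univ φ
  continuous : Continuous φ
  add_sub_le : ∀ x y, φ (x + y) + φ (x - y) ≤ 2 * φ x + κ * φ y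
  norm_rpow_le : ∀ x, ‖x‖ ^ r ≤ φ x
  le_mul_norm_rpow : ∀ x, φ x ≤ C * ‖x‖ ^ r

theorem IsRSmooth.exists_isSmoothGauge {B : Type*} [NormedAddCommGroup B] [NormedSpace ℝ B]
    {r : ℝ} (hB : IsRSmooth B r) (hr₁ : 1 ≤ r) (hr₂ : r ≤ 2) :
    ∃ (φ : B → ℝ) (κ C : ℝ), IsSmoothGauge φ r κ C := by
  obtain ⟨N, ⟨c, C, hc, hC, hN⟩, M, hM⟩ := hB
  have hcont : Continuous N := by
    refine (LipschitzWith.of_le_add_mul' C fun x y => ?_).continuous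
    have h := map_add_le_add N y (x - y)
    rw [add_sub_cancel] at h
    rw [dist_eq_norm]
    exact h.trans (add_le_add_right (hN _).2 _)
  refine ⟨fun x => (c ^ r)⁻¹ * N x ^ r, 2 * 2 ^ r + 2 * max M 0 + 2, (c ^ r)⁻¹ * C ^ r,
    hr₁, by positivity, by positivity, ?_, ?_, fun x y => ?_, fun x => ?_, fun x => ?_⟩
  · exact (convexOn_seminorm_rpow N hr₁).smul (by positivity)
  · exact (hcont.rpow_const fun _ => Or.inr (by linarith)).const_mul _
  · have h := seminorm_rpow_add_rpow_le hr₁ hr₂ (le_max_right M 0)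
      (fun t ht x y hx hy => (hM t ht x y hx hy).trans (le_max_left _ _)) x y
    have h' := mul_le_mul_of_nonneg_left h (by positivity : 0 ≤ (c ^ r)⁻¹)
    linarith
  · rw [le_inv_mul_iff₀ (by positivity), ← Real.mul_rpow hc.le (norm_nonneg _)]
    exact Real.rpow_le_rpow (by positivity) (hN x).1 (by linarith)
  · rw [mul_assoc, ← Real.mul_rpow hC.le (norm_nonneg _)]
    gcongr
    exact (hN x).2

lemma condExp_sum_ae_eq_zero {Ω τ B : Type*} [NormedAddCommGroup B] [NormedSpace ℝ B]
    [CompleteSpace B] {𝒢 mΩ : MeasurableSpace Ω} {μ : Measure Ω} {F : τ → Ω → B} (T : Finset τ)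
    (hF : ∀ a ∈ T, Integrable (F a) μ) (hzero : ∀ a ∈ T, μ[F a | 𝒢] =ᵐ[μ] 0) :
    μ[fun ω => ∑ a ∈ T, F a ω | 𝒢] =ᵐ[μ] 0 := by
  have hsum := condExp_finsetSum hF 𝒢
  rw [Finset.sum_fn] at hsum
  refine hsum.trans ?_
  filter_upwards [(ae_ball_iff T.countable_toSet).2 hzero] with ω hω
  rw [Finset.sum_apply]
  exact Finset.sum_eq_zero hω

namespace IsSmoothGauge

variable {B : Type*} [NormedAddCommGroup B] [NormedSpace ℝ B] {φ : B → ℝ} {r κ C : ℝ}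

lemma nonneg (hφ : IsSmoothGauge φ r κ C) (x : B) : 0 ≤ φ x :=
  (Real.rpow_nonneg (norm_nonneg x) r).trans (hφ.norm_rpow_le x)

lemma map_zero (hφ : IsSmoothGauge φ r κ C) : φ 0 = 0 :=
  le_antisymm (by simpa [Real.zero_rpow (zero_lt_one.trans_le hφ.one_le).ne']
    using hφ.le_mul_norm_rpow 0) (hφ.nonneg 0)

lemma one_le_ofReal (hφ : IsSmoothGauge φ r κ C) : 1 ≤ ENNReal.ofReal r :=
  ENNReal.one_le_ofReal.2 hφ.one_le

variable {Ω : Type*} {𝒢 mΩ : MeasurableSpace Ω} {μ : Measure Ω} {X D : Ω → B}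

lemma integrable_comp (hφ : IsSmoothGauge φ r κ C) (hX : MemLp X (ENNReal.ofReal r) μ) :
    Integrable (fun ω => φ (X ω)) μ := by
  have hr : 0 ≤ r := zero_le_one.trans hφ.one_le
  have hint : Integrable (fun ω => ‖X ω‖ ^ r) μ := by
    simpa [ENNReal.toReal_ofReal hr] using
      hX.integrable_norm_rpow (zero_lt_one.trans_le hφ.one_le_ofReal).ne' ENNReal.ofReal_ne_top
  refine (hint.const_mul C).mono' (hφ.continuous.comp_aestronglyMeasurable hX.1) ?_
  refine .of_forall fun ω => ?_
  rw [Real.norm_of_nonneg (hφ.nonneg _)]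
  exact hφ.le_mul_norm_rpow _

lemma ofReal_integral_comp_le (hφ : IsSmoothGauge φ r κ C) (hX : MemLp X (ENNReal.ofReal r) μ) :
    ENNReal.ofReal (∫ ω, φ (X ω) ∂μ) ≤ ENNReal.ofReal C * ∫⁻ ω, ‖X ω‖ₑ ^ r ∂μ := by
  rw [ofReal_integral_eq_lintegral_ofReal (hφ.integrable_comp hX)
    (.of_forall fun ω => hφ.nonneg _), ← lintegral_const_mul' _ _ ENNReal.ofReal_ne_top]
  refine lintegral_mono fun ω => ?_
  rw [← ofReal_norm, ENNReal.ofReal_rpow_of_nonneg (norm_nonneg _) (zero_le_one.trans hφ.one_le),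
    ← ENNReal.ofReal_mul hφ.C_nonneg]
  exact ENNReal.ofReal_le_ofReal (hφ.le_mul_norm_rpow _)

variable [CompleteSpace B] [IsProbabilityMeasure μ]

lemma integral_le_integral_sub (hφ : IsSmoothGauge φ r κ C) (h𝒢 : 𝒢 ≤ mΩ)
    (hX : StronglyMeasurable[𝒢] X) (hXr : MemLp X (ENNReal.ofReal r) μ)
    (hDr : MemLp D (ENNReal.ofReal r) μ) (hD : μ[D | 𝒢] =ᵐ[μ] 0) :
    ∫ ω, φ (X ω) ∂μ ≤ ∫ ω, φ (X ω - D ω) ∂μ := by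
  have hXi := hXr.integrable hφ.one_le_ofReal
  have hDi := hDr.integrable hφ.one_le_ofReal
  have hcond : μ[X - D | 𝒢] =ᵐ[μ] X := by
    filter_upwards [condExp_sub hXi hDi 𝒢, hD] with ω h₁ h₂
    simp [h₁, h₂, condExp_of_stronglyMeasurable h𝒢 hX hXi]
  have hint := hφ.integrable_comp (hXr.sub hDr)
  have hjensen := hφ.convexOn.map_condExp_le_univ h𝒢
    hφ.continuous.lowerSemicontinuous (hXi.sub hDi) hint
  calc ∫ ω, φ (X ω) ∂μ ≤ ∫ ω, μ[φ ∘ (X - D) | 𝒢] ω ∂μ := by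
        refine integral_mono_ae (hφ.integrable_comp hXr) integrable_condExp ?_
        filter_upwards [hcond, hjensen] with ω h₁ h₂
        simpa [h₁] using h₂
    _ = ∫ ω, φ (X ω - D ω) ∂μ := integral_condExp h𝒢

lemma integral_add_le (hφ : IsSmoothGauge φ r κ C) (h𝒢 : 𝒢 ≤ mΩ)
    (hX : StronglyMeasurable[𝒢] X) (hXr : MemLp X (ENNReal.ofReal r) μ)
    (hDr : MemLp D (ENNReal.ofReal r) μ) (hD : μ[D | 𝒢] =ᵐ[μ] 0) :
    ∫ ω, φ (X ω + D ω) ∂μ ≤ ∫ ω, φ (X ω) ∂μ + κ * ∫ ω, φ (D ω) ∂μ := by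
  have hXi := hφ.integrable_comp hXr
  have hDi := hφ.integrable_comp hDr
  have hadd := hφ.integrable_comp (hXr.add hDr)
  have hsub := hφ.integrable_comp (hXr.sub hDr)
  simp only [Pi.add_apply, Pi.sub_apply] at hadd hsub
  have hsum : ∫ ω, φ (X ω + D ω) ∂μ + ∫ ω, φ (X ω - D ω) ∂μ
      ≤ 2 * ∫ ω, φ (X ω) ∂μ + κ * ∫ ω, φ (D ω) ∂μ := by
    rw [← integral_add hadd hsub, ← integral_const_mul,
      ← integral_const_mul, ← integral_add (hXi.const_mul 2) (hDi.const_mul κ)]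
    exact integral_mono (hadd.add hsub)
      ((hXi.const_mul 2).add (hDi.const_mul κ)) fun ω => hφ.add_sub_le _ _
  linarith [hφ.integral_le_integral_sub h𝒢 hX hXr hDr hD]

lemma integral_sum_le_filter_add_filter {τ : Type*} (hφ : IsSmoothGauge φ r κ C) (h𝒢 : 𝒢 ≤ mΩ)
    {F : τ → Ω → B} (T : Finset τ) (p : τ → Prop) [DecidablePred p]
    (hF : ∀ a ∈ T, MemLp (F a) (ENNReal.ofReal r) μ)
    (hmeas : ∀ a ∈ T, ¬ p a → StronglyMeasurable[𝒢] (F a))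
    (hzero : ∀ a ∈ T, p a → μ[F a | 𝒢] =ᵐ[μ] 0) :
    ∫ ω, φ (∑ a ∈ T, F a ω) ∂μ ≤ ∫ ω, φ (∑ a ∈ T with ¬ p a, F a ω) ∂μ
      + κ * ∫ ω, φ (∑ a ∈ T with p a, F a ω) ∂μ := by
  have hF' : ∀ {a} {q : τ → Prop} [DecidablePred q], a ∈ T.filter q →
      MemLp (F a) (ENNReal.ofReal r) μ := fun ha => hF _ (Finset.mem_of_mem_filter _ ha)
  simp_rw [← fun ω => Finset.sum_filter_not_add_sum_filter T p fun a => F a ω]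
  refine hφ.integral_add_le h𝒢 (Finset.stronglyMeasurable_fun_sum _ fun a ha => ?_)
    (memLp_finsetSum _ fun a ha => hF' ha) (memLp_finsetSum _ fun a ha => hF' ha)
    (condExp_sum_ae_eq_zero _ (fun a ha => (hF' ha).integrable hφ.one_le_ofReal) fun a ha => ?_)
  · exact hmeas a (Finset.mem_filter.1 ha).1 (Finset.mem_filter.1 ha).2
  · exact hzero a (Finset.mem_filter.1 ha).1 (Finset.mem_filter.1 ha).2

theorem integral_sum_le {ι τ : Type*} (hφ : IsSmoothGauge φ r κ C)
    {𝒢 : ι → MeasurableSpace Ω} (h𝒢 : ∀ i, 𝒢 i ≤ mΩ) {F : τ → Ω → B} (s : Finset ι)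
    (T : Finset τ) (supp : τ → Finset ι) (hinj : Set.InjOn supp T) (hsupp : ∀ a ∈ T, supp a ⊆ s)
    (hF : ∀ a ∈ T, MemLp (F a) (ENNReal.ofReal r) μ)
    (hmeas : ∀ a ∈ T, ∀ i ∈ s, i ∉ supp a → StronglyMeasurable[𝒢 i] (F a))
    (hzero : ∀ a ∈ T, ∀ i ∈ supp a, μ[F a | 𝒢 i] =ᵐ[μ] 0) :
    ∫ ω, φ (∑ a ∈ T, F a ω) ∂μ ≤ ∑ a ∈ T, κ ^ (supp a).card * ∫ ω, φ (F a ω) ∂μ := by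
  classical
  induction s using Finset.induction_on generalizing T supp with
  | empty =>
    have hempty : ∀ a ∈ T, supp a = ∅ := fun a ha => Finset.subset_empty.1 (hsupp a ha)
    rcases T.eq_empty_or_nonempty with rfl | ⟨a, ha⟩
    · simp [hφ.map_zero]
    · obtain rfl : T = {a} := Finset.eq_singleton_iff_unique_mem.2
        ⟨ha, fun b hb => hinj hb ha ((hempty b hb).trans (hempty a ha).symm)⟩
      simp [hempty a ha]
  | insert i s his ih =>
    have hstep := hφ.integral_sum_le_filter_add_filter (h𝒢 i) T (i ∈ supp ·) hF
      (fun a ha => hmeas a ha i (s.mem_insert_self i)) (fun a ha => hzero a ha i)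
    have h₀ : ∀ {a}, a ∈ T.filter (i ∉ supp ·) → a ∈ T ∧ i ∉ supp a := (Finset.mem_filter.1 ·)
    have h₁ : ∀ {a}, a ∈ T.filter (i ∈ supp ·) → a ∈ T ∧ i ∈ supp a := (Finset.mem_filter.1 ·)
    have ih₀ := ih (T.filter (i ∉ supp ·)) supp (hinj.mono fun a ha => (h₀ ha).1)
      (fun a ha => (Finset.subset_insert_iff_of_notMem (h₀ ha).2).1 (hsupp a (h₀ ha).1))
      (fun a ha => hF a (h₀ ha).1)
      (fun a ha j hj => hmeas a (h₀ ha).1 j (Finset.mem_insert_of_mem hj))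
      (fun a ha => hzero a (h₀ ha).1)
    have ih₁ := ih (T.filter (i ∈ supp ·)) (fun a => (supp a).erase i)
      (fun a ha b hb hab => hinj (h₁ ha).1 (h₁ hb).1
        (Finset.erase_injOn' i (h₁ ha).2 (h₁ hb).2 hab))
      (fun a ha => Finset.subset_insert_iff.1 (hsupp a (h₁ ha).1))
      (fun a ha => hF a (h₁ ha).1)
      (fun a ha j hj hja => hmeas a (h₁ ha).1 j (Finset.mem_insert_of_mem hj) fun h =>
        hja (Finset.mem_erase.2 ⟨ne_of_mem_of_not_mem hj his, h⟩))
      (fun a ha j hj => hzero a (h₁ ha).1 j (Finset.mem_of_mem_erase hj))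
    refine (hstep.trans (add_le_add ih₀ (mul_le_mul_of_nonneg_left ih₁ hφ.κ_nonneg))).trans_eq ?_
    rw [← Finset.sum_filter_not_add_sum_filter T (i ∈ supp ·), Finset.mul_sum]
    refine congrArg _ (Finset.sum_congr rfl fun a ha => ?_)
    rw [← mul_assoc, ← pow_succ', Finset.card_erase_add_one (h₁ ha).2]

end IsSmoothGauge

section ProductMeasure

variable {ι : Type*} {X : ι → Type*} [∀ i, MeasurableSpace (X i)]

lemma update_mem_iff_of_measurableSet [DecidableEq ι] {i : ι} {A : Set (∀ i, X i)}
    (hA : MeasurableSet[cylinderEvents {i}ᶜ] A) (x : ∀ i, X i) (s : X i) :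
    Function.update x i s ∈ A ↔ x ∈ A := by
  have hle : cylinderEvents {i}ᶜ ≤
      @MeasurableSpace.invariants (∀ i, X i) ⊤ fun x => Function.update x i s := by
    refine iSup₂_le fun j hj => ?_
    rintro _ ⟨t, -, rfl⟩
    refine ⟨trivial, ?_⟩
    ext x
    simp [Function.update_of_ne hj]
  exact Set.ext_iff.1 (hle A hA).2 x

lemma stronglyMeasurable_integral_update [DecidableEq ι] {B : Type*} [NormedAddCommGroup B]
    [NormedSpace ℝ B] {i : ι} {Δ : Set ι} {f : (∀ i, X i) → B}
    (hf : StronglyMeasurable[cylinderEvents Δ] f) (Q : Measure (X i)) [SFinite Q] :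
    StronglyMeasurable[cylinderEvents (Δ \ {i})] fun x => ∫ s, f (Function.update x i s) ∂Q := by
  have hupdate : @Measurable _ _ (.prod (cylinderEvents (Δ \ {i})) inferInstance)
      (cylinderEvents Δ) fun q : (∀ i, X i) × X i => Function.update q.1 i q.2 := by
    rw [measurable_cylinderEvents_iff]
    intro j hj
    rcases eq_or_ne j i with rfl | hji
    · simpa using @measurable_snd _ _ (cylinderEvents (Δ \ {j})) _
    · simp only [Function.update_of_ne hji]
      exact (measurable_cylinderEvent_apply (Δ := Δ \ {i}) ⟨hj, hji⟩).comp
        (@measurable_fst _ _ (cylinderEvents (Δ \ {i})) _)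
  exact @StronglyMeasurable.integral_prod_right' _ _ _ (cylinderEvents (Δ \ {i})) _ _ _ _ _ _
    (hf.comp_measurable hupdate)

variable (P : ∀ i, Measure (X i)) [∀ i, IsProbabilityMeasure (P i)]

lemma measurePreserving_update [DecidableEq ι] (i : ι) :
    MeasurePreserving (fun q : (∀ i, X i) × X i => Function.update q.1 i q.2)
      ((Measure.infinitePi P).prod (P i)) (Measure.infinitePi P) := by
  refine ⟨measurable_update', Measure.eq_infinitePi _ fun s t ht => ?_⟩
  have hpre : (fun q : (∀ i, X i) × X i => Function.update q.1 i q.2) ⁻¹' (s : Set ι).pi t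
      = ((s.erase i : Finset ι) : Set ι).pi t ×ˢ {u | i ∈ s → u ∈ t i} := by
    ext ⟨x, u⟩
    simp only [Set.mem_preimage, Set.mem_pi, Finset.mem_coe, Set.mem_prod, Finset.mem_erase,
      Set.mem_ofPred_eq]
    refine ⟨fun h => ⟨fun j hj => by simpa [hj.1] using h j hj.2,
      fun hi => by simpa using h i hi⟩, fun h j hj => ?_⟩
    rcases eq_or_ne j i with rfl | hji
    · simpa using h.2 hj
    · simpa [hji] using h.1 j ⟨hji, hj⟩
  rw [Measure.map_apply measurable_update' (.pi s.countable_toSet fun _ _ => ht _), hpre,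
    Measure.prod_prod, Measure.infinitePi_pi _ fun i _ => ht i]
  by_cases hi : i ∈ s
  · simp [hi, Finset.prod_erase_mul]
  · simp [hi]

variable {B : Type*} [NormedAddCommGroup B] [NormedSpace ℝ B] [CompleteSpace B] {P}

lemma condExp_cylinderEvents_compl_singleton [DecidableEq ι] {f : (∀ i, X i) → B}
    (hfm : StronglyMeasurable f) (hf : Integrable f (Measure.infinitePi P)) (i : ι) :
    (Measure.infinitePi P)[f | cylinderEvents {i}ᶜ]
      =ᵐ[Measure.infinitePi P] fun x => ∫ s, f (Function.update x i s) ∂P i := by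
  have hmp := measurePreserving_update P i
  have hint : ∀ {g : (∀ i, X i) → B}, Integrable g (Measure.infinitePi P) →
      Integrable (fun q : (∀ i, X i) × X i => g (Function.update q.1 i q.2))
        ((Measure.infinitePi P).prod (P i)) := fun hg =>
    (hmp.integrable_comp hg.aestronglyMeasurable).2 hg
  refine (ae_eq_condExp_of_forall_setIntegral_eq cylinderEvents_le_pi hf
    (fun A _ _ => (hint hf).integral_prod_left.integrableOn) (fun A hA _ => ?_) ?_).symm
  · have hA' := cylinderEvents_le_pi A hA
    calc ∫ x in A, ∫ s, f (Function.update x i s) ∂P i ∂Measure.infinitePi P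
        = ∫ x, ∫ s, A.indicator f (Function.update x i s) ∂P i ∂Measure.infinitePi P := by
          rw [← integral_indicator hA']
          refine integral_congr_ae (.of_forall fun x => ?_)
          by_cases hx : x ∈ A <;> simp [hx, Set.indicator, update_mem_iff_of_measurableSet hA]
      _ = ∫ q, A.indicator f (Function.update q.1 i q.2) ∂(Measure.infinitePi P).prod (P i) :=
          (integral_prod _ (hint (hf.indicator hA'))).symm
      _ = ∫ x in A, f x ∂Measure.infinitePi P := by
          have h := integral_map hmp.aemeasurable (f := A.indicator f)
            (hmp.map_eq.symm ▸ (hf.indicator hA').1)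
          rw [hmp.map_eq] at h
          rw [← integral_indicator hA']
          exact h.symm
  · rw [Set.compl_eq_univ_sdiff]
    exact (stronglyMeasurable_integral_update (by rwa [cylinderEvents_univ]) _).aestronglyMeasurable

lemma condExp_condExp_cylinderEvents {f : (∀ i, X i) → B} (Δ : Set ι) (i : ι) :
    (Measure.infinitePi P)[(Measure.infinitePi P)[f | cylinderEvents Δ] | cylinderEvents {i}ᶜ]
      =ᵐ[Measure.infinitePi P] (Measure.infinitePi P)[f | cylinderEvents (Δ \ {i})] := by
  classical
  set ν := Measure.infinitePi P
  have havg := condExp_cylinderEvents_compl_singleton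
    (stronglyMeasurable_condExp.mono cylinderEvents_le_pi)
    (integrable_condExp (μ := ν) (f := f) (m := cylinderEvents Δ)) i
  have hmeas := stronglyMeasurable_integral_update (i := i) (Q := P i)
    (stronglyMeasurable_condExp (μ := ν) (f := f) (m := cylinderEvents Δ))
  calc ν[ν[f | cylinderEvents Δ] | cylinderEvents {i}ᶜ]
      =ᵐ[ν] ν[ν[ν[f | cylinderEvents Δ] | cylinderEvents {i}ᶜ] | cylinderEvents (Δ \ {i})] := by
        refine havg.trans ?_
        rw [← condExp_of_stronglyMeasurable cylinderEvents_le_pi hmeas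
          (integrable_condExp.congr havg)]
        exact (condExp_congr_ae havg).symm
    _ =ᵐ[ν] ν[ν[f | cylinderEvents Δ] | cylinderEvents (Δ \ {i})] :=
        condExp_condExp_of_le (cylinderEvents_mono fun j hj => hj.2) cylinderEvents_le_pi
    _ =ᵐ[ν] ν[f | cylinderEvents (Δ \ {i})] :=
        condExp_condExp_of_le (cylinderEvents_mono Set.sdiff_subset) cylinderEvents_le_pi

lemma condExp_cylinderEvents_comm (f : (∀ i, X i) → B) (i j : ι) :
    (Measure.infinitePi P)[(Measure.infinitePi P)[f | cylinderEvents {i}ᶜ] | cylinderEvents {j}ᶜ]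
      =ᵐ[Measure.infinitePi P]
    (Measure.infinitePi P)[(Measure.infinitePi P)[f | cylinderEvents {j}ᶜ] |
      cylinderEvents {i}ᶜ] := by
  refine (condExp_condExp_cylinderEvents _ _).trans ?_
  rw [show ({i}ᶜ \ {j} : Set ι) = {j}ᶜ \ {i} by ext; simp [and_comm]]
  exact (condExp_condExp_cylinderEvents _ _).symm

end ProductMeasure

lemma submartingale_convexOn_comp {ι Ω B : Type*} [Preorder ι] [NormedAddCommGroup B]
    [NormedSpace ℝ B] [CompleteSpace B] {mΩ : MeasurableSpace Ω} {μ : Measure Ω}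
    [IsFiniteMeasure μ] {ℱ : Filtration ι mΩ} {M : ι → Ω → B} {φ : B → ℝ} (hM : Martingale M ℱ μ)
    (hφ : ConvexOn ℝ Set.univ φ) (hφc : Continuous φ)
    (hint : ∀ i, Integrable (fun ω => φ (M i ω)) μ) :
    Submartingale (fun i ω => φ (M i ω)) ℱ μ := by
  refine ⟨fun i => hφc.comp_stronglyMeasurable (hM.1 i), fun i j hij => ?_, hint⟩
  filter_upwards [hM.2 i j hij, hφ.map_condExp_le_univ (ℱ.le i) hφc.lowerSemicontinuous
    (hM.integrable j) (hint j)] with ω hmart hjensen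
  rw [← hmart]
  exact hjensen

theorem IsSmoothGauge.mul_measure_exists_le_enorm_le {Ω B : Type*} [NormedAddCommGroup B]
    [NormedSpace ℝ B] [CompleteSpace B] {mΩ : MeasurableSpace Ω} {μ : Measure Ω}
    [IsFiniteMeasure μ] {φ : B → ℝ} {r κ C : ℝ} (hφ : IsSmoothGauge φ r κ C)
    {ℱ : Filtration ℕ mΩ} {M : ℕ → Ω → B} (hM : Martingale M ℱ μ)
    (hMr : ∀ n, MemLp (M n) (ENNReal.ofReal r) μ) (c : NNReal) (N : ℕ) :
    (c : ENNReal) ^ r * μ {ω | ∃ n ≤ N, c ≤ ‖M n ω‖ₑ} ≤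
      ENNReal.ofReal (∫ ω, φ (M N ω) ∂μ) := by
  have hr : 0 ≤ r := zero_le_one.trans hφ.one_le
  have hsub := submartingale_convexOn_comp hM hφ.convexOn hφ.continuous
    fun n => hφ.integrable_comp (hMr n)
  have hdoob := maximal_ineq hsub (fun n ω => hφ.nonneg (M n ω)) (ε := c ^ r) N
  rw [← ENNReal.coe_rpow_of_nonneg c hr]
  refine (mul_le_mul_right (measure_mono ?_) _).trans (hdoob.trans ?_)
  · rintro ω ⟨n, hn, hcn⟩
    rw [Set.mem_ofPred_eq, Finset.le_sup'_iff]
    refine ⟨n, Finset.mem_range_succ_iff.2 hn, ?_⟩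
    rw [NNReal.coe_rpow]
    exact (Real.rpow_le_rpow c.2 (by exact_mod_cast hcn) hr).trans (hφ.norm_rpow_le _)
  · exact ENNReal.ofReal_le_ofReal (setIntegral_le_integral (hφ.integrable_comp (hMr N))
      (.of_forall fun ω => hφ.nonneg _))

section HoeffdingProjection

variable {ι Ω B : Type*} [NormedAddCommGroup B] [NormedSpace ℝ B]
  {mΩ : MeasurableSpace Ω} {μ : Measure Ω} {𝒢 : ι → MeasurableSpace Ω} {f h : Ω → B}

/-- The Hoeffding projection of `f` along the σ-algebras `𝒢 k`, `k ∈ l`: the operators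
`g ↦ g - μ[g | 𝒢 k]` are applied to `f` one after the other. When these operators commute, the
result is centred given each `𝒢 k`. -/
noncomputable def hoeffdingProjection (μ : Measure Ω) (𝒢 : ι → MeasurableSpace Ω) (l : List ι)
    (f : Ω → B) : Ω → B :=
  l.foldr (fun k g => g - μ[g | 𝒢 k]) f

lemma hoeffdingProjection_cons (k : ι) (l : List ι) (f : Ω → B) :
    hoeffdingProjection μ 𝒢 (k :: l) f
      = hoeffdingProjection μ 𝒢 l f - μ[hoeffdingProjection μ 𝒢 l f | 𝒢 k] := rfl

lemma stronglyMeasurable_hoeffdingProjection (h𝒢 : ∀ k, 𝒢 k ≤ mΩ) (hf : StronglyMeasurable f)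
    (l : List ι) : StronglyMeasurable (hoeffdingProjection μ 𝒢 l f) := by
  induction l with
  | nil => exact hf
  | cons k l ih => exact ih.sub (stronglyMeasurable_condExp.mono (h𝒢 k))

variable [CompleteSpace B]

lemma memLp_hoeffdingProjection {q : ENNReal} (hq : 1 ≤ q) (hf : MemLp f q μ) (l : List ι) :
    MemLp (hoeffdingProjection μ 𝒢 l f) q μ := by
  induction l with
  | nil => exact hf
  | cons k l ih => exact ih.sub (ih.condExp hq)

lemma integrable_hoeffdingProjection (hf : Integrable f μ) (l : List ι) :
    Integrable (hoeffdingProjection μ 𝒢 l f) μ :=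
  memLp_one_iff_integrable.1 (memLp_hoeffdingProjection le_rfl (memLp_one_iff_integrable.2 hf) l)

lemma eLpNorm_hoeffdingProjection_le {q : ENNReal} (hq : 1 ≤ q) (hf : MemLp f q μ) (l : List ι) :
    eLpNorm (hoeffdingProjection μ 𝒢 l f) q μ ≤ 2 ^ l.length * eLpNorm f q μ := by
  induction l with
  | nil => simp [hoeffdingProjection]
  | cons k l ih =>
    set g := hoeffdingProjection μ 𝒢 l f
    have hg : MemLp g q μ := memLp_hoeffdingProjection hq hf l
    calc eLpNorm (g - μ[g | 𝒢 k]) q μ ≤ eLpNorm g q μ + eLpNorm (μ[g | 𝒢 k]) q μ :=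
          eLpNorm_sub_le hg.1 (hg.condExp hq).1 hq
      _ ≤ eLpNorm g q μ + eLpNorm g q μ := by gcongr; exact eLpNorm_condExp_le_eLpNorm g hq
      _ = 2 * eLpNorm g q μ := (two_mul _).symm
      _ ≤ 2 * (2 ^ l.length * eLpNorm f q μ) := by gcongr
      _ = 2 ^ (k :: l).length * eLpNorm f q μ := by rw [← mul_assoc, ← pow_succ', List.length_cons]

lemma lintegral_enorm_rpow_hoeffdingProjection_le {q : ℝ} (hq : 1 ≤ q)
    (hf : MemLp f (ENNReal.ofReal q) μ) (l : List ι) :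
    ∫⁻ ω, ‖hoeffdingProjection μ 𝒢 l f ω‖ₑ ^ q ∂μ
      ≤ ((2 : ENNReal) ^ q) ^ l.length * ∫⁻ ω, ‖f ω‖ₑ ^ q ∂μ := by
  have hq₀ : 0 < q := zero_lt_one.trans_le hq
  have hnorm : ∀ g : Ω → B, ∫⁻ ω, ‖g ω‖ₑ ^ q ∂μ = eLpNorm g (ENNReal.ofReal q) μ ^ q := by
    intro g
    rw [lintegral_rpow_enorm_eq_rpow_eLpNorm' hq₀,
      eLpNorm_eq_eLpNorm' (by simpa using hq₀) (by simp), ENNReal.toReal_ofReal hq₀.le]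
  rw [hnorm, hnorm, ← ENNReal.rpow_natCast, ← ENNReal.rpow_mul, mul_comm q, ENNReal.rpow_mul,
    ENNReal.rpow_natCast, ← ENNReal.mul_rpow_of_nonneg _ _ hq₀.le]
  exact ENNReal.rpow_le_rpow
    (eLpNorm_hoeffdingProjection_le (ENNReal.one_le_ofReal.2 hq) hf l) hq₀.le

lemma condExp_hoeffdingProjection [IsFiniteMeasure μ] (h𝒢 : ∀ k, 𝒢 k ≤ mΩ)
    (hcomm : ∀ (g : Ω → B) (i j : ι), μ[μ[g | 𝒢 i] | 𝒢 j] =ᵐ[μ] μ[μ[g | 𝒢 j] | 𝒢 i])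
    (hf : Integrable f μ) {l : List ι} {i : ι} (hi : i ∈ l) :
    μ[hoeffdingProjection μ 𝒢 l f | 𝒢 i] =ᵐ[μ] 0 := by
  induction l with
  | nil => simp at hi
  | cons k l ih =>
    set g := hoeffdingProjection μ 𝒢 l f
    have hg : Integrable g μ := integrable_hoeffdingProjection hf l
    suffices hcond : μ[μ[g | 𝒢 k] | 𝒢 i] =ᵐ[μ] μ[g | 𝒢 i] by
      filter_upwards [condExp_sub hg integrable_condExp (𝒢 i), hcond] with ω hsub hω
      rw [hoeffdingProjection_cons, hsub, Pi.sub_apply, hω, sub_self, Pi.zero_apply]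
    rcases List.mem_cons.1 hi with rfl | hil
    · exact condExp_condExp_of_le le_rfl (h𝒢 i)
    · have hzero : μ[μ[g | 𝒢 i] | 𝒢 k] =ᵐ[μ] 0 :=
        (condExp_congr_ae (ih hil)).trans (by rw [condExp_zero])
      exact (hcomm g k i).trans (hzero.trans (ih hil).symm)

lemma hoeffdingProjection_sub_ae_eq (hh : Integrable h μ) (hf : Integrable f μ) {l : List ι}
    (hzero : ∀ k ∈ l, μ[h | 𝒢 k] =ᵐ[μ] 0) :
    hoeffdingProjection μ 𝒢 l (h - f) =ᵐ[μ] h - hoeffdingProjection μ 𝒢 l f := by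
  induction l with
  | nil => rfl
  | cons k l ih =>
    have ih' := ih fun j hj => hzero j (List.mem_cons_of_mem k hj)
    filter_upwards [ih', condExp_congr_ae ih',
      condExp_sub hh (integrable_hoeffdingProjection hf l) (𝒢 k),
      hzero k List.mem_cons_self] with ω hω hcongr hsub hhω
    simp only [hoeffdingProjection_cons, Pi.sub_apply, Pi.zero_apply] at *
    rw [hω, hcongr, hsub, hhω]
    abel

end HoeffdingProjection

lemma condExp_comp_comap_ae_eq {Ω E B : Type*} [NormedAddCommGroup B] [NormedSpace ℝ B]
    [CompleteSpace B] {mΩ : MeasurableSpace Ω} {𝒢 mE : MeasurableSpace E} {μ : Measure Ω}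
    {ν : Measure E} [IsFiniteMeasure μ] [IsFiniteMeasure ν] {Y : Ω → E}
    (hY : MeasurePreserving Y μ ν) (h𝒢 : 𝒢 ≤ mE) {f : E → B} (hf : Integrable f ν) :
    μ[fun ω => f (Y ω) | 𝒢.comap Y] =ᵐ[μ] fun ω => ν[f | 𝒢] (Y ω) := by
  have hcomap : 𝒢.comap Y ≤ mΩ := (MeasurableSpace.comap_mono h𝒢).trans hY.measurable.comap_le
  have hset : ∀ {g : E → B} {A : Set E}, Integrable g ν → MeasurableSet A →
      ∫ ω in Y ⁻¹' A, g (Y ω) ∂μ = ∫ x in A, g x ∂ν := fun {g A} hg hA => by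
    rw [← hY.map_eq, setIntegral_map hA (hY.map_eq.symm ▸ hg.1) hY.aemeasurable]
  refine (ae_eq_condExp_of_forall_setIntegral_eq hcomap (hY.integrable_comp_of_integrable hf)
    (fun A _ _ => (hY.integrable_comp_of_integrable integrable_condExp).integrableOn) ?_
    ?_).symm
  · rintro _ ⟨A, hA, rfl⟩ -
    exact (hset integrable_condExp (h𝒢 A hA)).trans
      ((setIntegral_condExp h𝒢 hf hA).trans (hset hf (h𝒢 A hA)).symm)
  · exact (stronglyMeasurable_condExp.comp_measurable
      (comap_measurable Y)).aestronglyMeasurable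

section Cylinder

variable {Ω ι κ : Type*} {X : ι → Type*} [∀ i, MeasurableSpace (X i)]

lemma comap_cylinderEvents (Y : Ω → ∀ i, X i) (Δ : Set ι) :
    (cylinderEvents Δ).comap Y = ⨆ i ∈ Δ, MeasurableSpace.comap (fun ω => Y ω i) inferInstance := by
  simp only [cylinderEvents, MeasurableSpace.comap_iSup, MeasurableSpace.comap_comp]
  rfl

lemma comap_comp_cylinderEvents (e : κ → ι) (Δ : Set κ) :
    (cylinderEvents Δ).comap (fun (x : ∀ i, X i) k => x (e k)) = cylinderEvents (e '' Δ) := by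
  rw [comap_cylinderEvents, cylinderEvents, iSup_image]

lemma stronglyMeasurable_comp_cylinderEvents {B : Type*} [TopologicalSpace B] {e : κ → ι}
    {g : (∀ k, X (e k)) → B} (hg : StronglyMeasurable g) {Δ : Set ι} (hΔ : ∀ k, e k ∈ Δ) :
    StronglyMeasurable[cylinderEvents Δ] fun x : ∀ i, X i => g fun k => x (e k) :=
  hg.comp_measurable ((@measurable_pi_iff _ _ _ (cylinderEvents Δ) _ _).2 fun k =>
    measurable_cylinderEvent_apply (hΔ k))

lemma measurePreserving_comp_of_injective (P : ∀ i, Measure (X i))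
    [∀ i, IsProbabilityMeasure (P i)] {e : κ → ι} (he : e.Injective) :
    MeasurePreserving (fun (x : ∀ i, X i) k => x (e k)) (Measure.infinitePi P)
      (Measure.infinitePi fun k => P (e k)) :=
  ⟨measurable_pi_iff.2 fun k => measurable_pi_apply (e k),
    Measure.map_infinitePi_infinitePi_of_inj he⟩

end Cylinder

/-- `g` is a canonical (completely degenerate) kernel for the measure `ν` on a product space: an
integrable function whose conditional expectation given all coordinates but one vanishes, whichever
coordinate is left out. -/
structure IsCanonicalKernel {ι B : Type*} [NormedAddCommGroup B] [NormedSpace ℝ B]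
    [CompleteSpace B] {X : ι → Type*} [∀ i, MeasurableSpace (X i)] (ν : Measure (∀ i, X i))
    (g : (∀ i, X i) → B) : Prop where
  stronglyMeasurable : StronglyMeasurable g
  integrable : Integrable g ν
  condExp_eq_zero : ∀ i, ν[g | cylinderEvents {i}ᶜ] =ᵐ[ν] 0

namespace IsCanonicalKernel

variable {ι κ B : Type*} [NormedAddCommGroup B] [NormedSpace ℝ B] [CompleteSpace B]
  {X : ι → Type*} [∀ i, MeasurableSpace (X i)] {P : ∀ i, Measure (X i)}
  [∀ i, IsProbabilityMeasure (P i)]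

lemma condExp_comp_eq_zero {e : κ → ι} (he : e.Injective) {g : (∀ k, X (e k)) → B}
    (hg : IsCanonicalKernel (Measure.infinitePi fun k => P (e k)) g) (k : κ) :
    (Measure.infinitePi P)[fun x => g fun k => x (e k) | cylinderEvents {e k}ᶜ]
      =ᵐ[Measure.infinitePi P] 0 := by
  classical
  set ν := Measure.infinitePi P
  set f : (∀ i, X i) → B := fun x => g fun k => x (e k)
  have hY := measurePreserving_comp_of_injective P he
  have hf : ν[f | cylinderEvents (Set.range e)] = f :=
    condExp_of_stronglyMeasurable cylinderEvents_le_pi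
      (stronglyMeasurable_comp_cylinderEvents hg.stronglyMeasurable Set.mem_range_self)
      (hY.integrable_comp_of_integrable hg.integrable)
  have hΔ : Set.range e \ {e k} = e '' {k}ᶜ := by
    rw [Set.image_compl_eq_range_sdiff_image he, Set.image_singleton]
  calc ν[f | cylinderEvents {e k}ᶜ]
      = ν[ν[f | cylinderEvents (Set.range e)] | cylinderEvents {e k}ᶜ] := by rw [hf]
    _ =ᵐ[ν] ν[f | cylinderEvents (Set.range e \ {e k})] := condExp_condExp_cylinderEvents _ _
    _ = ν[f | (cylinderEvents {k}ᶜ).comap fun x k => x (e k)] := by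
      rw [hΔ, comap_comp_cylinderEvents]
    _ =ᵐ[ν] 0 := (condExp_comp_comap_ae_eq hY cylinderEvents_le_pi hg.integrable).trans
      (hY.quasiMeasurePreserving.ae (hg.condExp_eq_zero k))

end IsCanonicalKernel

section IncTuples

variable {m n : ℕ} {i : Fin m → ℕ}

lemma mem_incTuples : i ∈ incTuples m n ↔ (∀ l, i l < n) ∧ StrictMono i := by
  simp only [incTuples, Finset.mem_filter, Fintype.mem_piFinset, Finset.mem_range]
  rfl

lemma incTuples_subset {n' : ℕ} (hn : n ≤ n') : incTuples m n ⊆ incTuples m n' := fun _ hi =>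
  mem_incTuples.2 ⟨fun l => ((mem_incTuples.1 hi).1 l).trans_le hn, (mem_incTuples.1 hi).2⟩

lemma exists_apply_eq_of_mem_incTuples_succ_sdiff (hi : i ∈ incTuples m (n + 1) \ incTuples m n) :
    ∃ l, i l = n := by
  rw [Finset.mem_sdiff, mem_incTuples, mem_incTuples] at hi
  by_contra! hne
  exact hi.2 ⟨fun l => lt_of_le_of_ne (Nat.lt_succ_iff.1 (hi.1.1 l)) (hne l), hi.1.2⟩

lemma injOn_image_univ_incTuples :
    Set.InjOn (fun i : Fin m → ℕ => Finset.univ.image i) (incTuples m n) := by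
  intro i hi j hj hij
  refine ((mem_incTuples.1 hi).2.range_inj (mem_incTuples.1 hj).2).1 ?_
  simpa using congrArg (fun A : Finset ℕ => (A : Set ℕ)) hij

lemma card_image_univ_of_mem_incTuples (hi : i ∈ incTuples m n) :
    (Finset.univ.image i).card = m := by
  rw [Finset.card_image_of_injective _ (mem_incTuples.1 hi).2.injective, Finset.card_fin]

lemma image_univ_subset_range_of_mem_incTuples (hi : i ∈ incTuples m n) :
    Finset.univ.image i ⊆ Finset.range n :=
  Finset.image_subset_iff.2 fun l _ => Finset.mem_range.2 ((mem_incTuples.1 hi).1 l)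

lemma card_incTuples_le (m n : ℕ) : (incTuples m n).card ≤ n.choose m := by
  rw [← Finset.card_range n, ← Finset.card_powersetCard, Finset.card_range n]
  exact Finset.card_le_card_of_injOn (fun i => Finset.univ.image i)
    (fun i hi => Finset.mem_powersetCard.2 ⟨image_univ_subset_range_of_mem_incTuples hi,
      card_image_univ_of_mem_incTuples hi⟩) injOn_image_univ_incTuples

end IncTuples

/-- The filtration of a sequence space generated by the coordinates; the `n`-th σ-algebra is
generated by the first `n` of them, those of index less than `n`. -/
def coordFiltration (X : ℕ → Type*) [∀ i, MeasurableSpace (X i)] :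
    Filtration ℕ (MeasurableSpace.pi (X := X)) where
  seq n := cylinderEvents (Set.Iio n)
  mono' _ _ h := cylinderEvents_mono (Set.Iio_subset_Iio h)
  le' _ := cylinderEvents_le_pi

/-- The law of a family, indexed by `ι`, of independent random variables with common law `P`. -/
noncomputable abbrev iidMeasure (ι : Type*) {S : Type*} [MeasurableSpace S] (P : Measure S) :
    Measure (ι → S) :=
  Measure.infinitePi fun _ => P

section UStatistic

variable {S B : Type*} [MeasurableSpace S] {P : Measure S} [IsProbabilityMeasure P]
  [NormedAddCommGroup B] {m n : ℕ} {g : (Fin m → S) → B}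

lemma measurePreserving_of_mem_incTuples {i : Fin m → ℕ} (hi : i ∈ incTuples m n) :
    MeasurePreserving (fun (x : ℕ → S) l => x (i l)) (iidMeasure ℕ P)
      (iidMeasure (Fin m) P) :=
  measurePreserving_comp_of_injective (fun _ => P) (mem_incTuples.1 hi).2.injective

lemma memLp_uStat {q : ENNReal} (hg : MemLp g q (iidMeasure (Fin m) P)) (n : ℕ) :
    MemLp (uStat g Function.eval n) q (iidMeasure ℕ P) :=
  memLp_finsetSum _ fun _ hi => hg.comp_measurePreserving (measurePreserving_of_mem_incTuples hi)

lemma stronglyMeasurable_uStat (hg : StronglyMeasurable g) (n : ℕ) :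
    StronglyMeasurable[coordFiltration (fun _ => S) n] (uStat g Function.eval n) :=
  Finset.stronglyMeasurable_fun_sum _ fun _ hi =>
    stronglyMeasurable_comp_cylinderEvents hg (mem_incTuples.1 hi).1

lemma mul_measure_exists_le_enorm_uStat_le (hg : StronglyMeasurable g) (c : ENNReal) (N : ℕ) :
    c * iidMeasure ℕ P {x | ∃ n ≤ N, c ≤ ‖uStat g Function.eval n x‖ₑ} ≤
      N.choose m * ∫⁻ y, ‖g y‖ₑ ∂iidMeasure (Fin m) P := by
  set ν := iidMeasure ℕ P
  set V : (ℕ → S) → ENNReal := fun x => ∑ i ∈ incTuples m N, ‖g fun l => x (i l)‖ₑ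
  have hle : ∀ n ≤ N, ∀ x, ‖uStat g Function.eval n x‖ₑ ≤ V x := fun n hn x =>
    (enorm_sum_le _ _).trans (Finset.sum_le_sum_of_subset (incTuples_subset hn))
  have hterm : ∀ i ∈ incTuples m N,
      Measurable (fun x : ℕ → S => ‖g fun l => x (i l)‖ₑ) ∧
      ∫⁻ x, ‖g fun l => x (i l)‖ₑ ∂ν = ∫⁻ y, ‖g y‖ₑ ∂iidMeasure (Fin m) P := fun i hi =>
    have hi' := measurePreserving_of_mem_incTuples (P := P) hi
    ⟨hg.enorm.comp hi'.measurable, hi'.lintegral_comp hg.enorm⟩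
  calc c * ν {x | ∃ n ≤ N, c ≤ ‖uStat g Function.eval n x‖ₑ} ≤ c * ν {x | c ≤ V x} := by
        gcongr
        rintro ⟨n, hn, hc⟩
        exact hc.trans (hle n hn _)
    _ ≤ ∫⁻ x, V x ∂ν :=
        mul_meas_ge_le_lintegral (Finset.measurable_fun_sum _ fun i hi => (hterm i hi).1) c
    _ = (incTuples m N).card * ∫⁻ y, ‖g y‖ₑ ∂iidMeasure (Fin m) P := by
        rw [lintegral_finsetSum _ fun i hi => (hterm i hi).1,
          Finset.sum_congr rfl fun i hi => (hterm i hi).2, Finset.sum_const, nsmul_eq_mul]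
    _ ≤ _ := by gcongr; exact card_incTuples_le m N

variable [NormedSpace ℝ B] [CompleteSpace B]

lemma IsCanonicalKernel.condExp_comp_incTuple_eq_zero
    (hg : IsCanonicalKernel (iidMeasure (Fin m) P) g) {i : Fin m → ℕ}
    (hi : i ∈ incTuples m n) (l : Fin m) :
    (iidMeasure ℕ P)[fun x => g fun l => x (i l) | cylinderEvents {i l}ᶜ]
      =ᵐ[iidMeasure ℕ P] 0 :=
  hg.condExp_comp_eq_zero (P := fun _ => P) (mem_incTuples.1 hi).2.injective l

lemma IsCanonicalKernel.martingale_uStat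
    (hg : IsCanonicalKernel (iidMeasure (Fin m) P) g) :
    Martingale (uStat g Function.eval) (coordFiltration fun _ => S)
      (iidMeasure ℕ P) := by
  have hint := memLp_one_iff_integrable.2 hg.integrable
  refine martingale_of_condExp_sub_eq_zero_nat (stronglyMeasurable_uStat hg.stronglyMeasurable)
    (fun n => memLp_one_iff_integrable.1 (memLp_uStat hint n)) fun n => ?_
  have hsub : uStat g Function.eval (n + 1) - uStat g Function.eval n =
      fun x => ∑ i ∈ incTuples m (n + 1) \ incTuples m n, g fun l => x (i l) := by
    ext x
    exact sub_eq_of_eq_add (Finset.sum_sdiff (incTuples_subset n.le_succ)).symm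
  rw [hsub]
  refine condExp_sum_ae_eq_zero _ (fun i hi => ?_) fun i hi => ?_
  · have hmp := measurePreserving_of_mem_incTuples (P := P) (Finset.mem_sdiff.1 hi).1
    exact hmp.integrable_comp_of_integrable hg.integrable
  · obtain ⟨l, hl⟩ := exists_apply_eq_of_mem_incTuples_succ_sdiff hi
    have hzero := hg.condExp_comp_incTuple_eq_zero (Finset.mem_sdiff.1 hi).1 l
    rw [hl] at hzero
    have hle : coordFiltration (fun _ => S) n ≤ cylinderEvents {n}ᶜ :=
      cylinderEvents_mono fun j (hj : j < n) => hj.ne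
    refine (condExp_condExp_of_le hle cylinderEvents_le_pi).symm.trans ?_
    exact (condExp_congr_ae hzero).trans (by rw [condExp_zero])

variable {φ : B → ℝ} {r κ C : ℝ}

lemma IsSmoothGauge.integral_uStat_le (hφ : IsSmoothGauge φ r κ C)
    (hg : IsCanonicalKernel (iidMeasure (Fin m) P) g)
    (hgr : MemLp g (ENNReal.ofReal r) (iidMeasure (Fin m) P)) (n : ℕ) :
    ∫ x, φ (uStat g Function.eval n x) ∂iidMeasure ℕ P ≤
      n.choose m * (κ ^ m * ∫ y, φ (g y) ∂iidMeasure (Fin m) P) := by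
  have hsum := hφ.integral_sum_le (μ := iidMeasure ℕ P)
    (𝒢 := fun k => cylinderEvents {k}ᶜ) (fun _ => cylinderEvents_le_pi)
    (F := fun i x => g fun l => x (i l)) (Finset.range n) (incTuples m n)
    (fun i => Finset.univ.image i) injOn_image_univ_incTuples
    (fun i hi => image_univ_subset_range_of_mem_incTuples hi)
    (fun i hi => hgr.comp_measurePreserving (measurePreserving_of_mem_incTuples hi))
    (fun _ _ k _ hk => stronglyMeasurable_comp_cylinderEvents (Δ := {k}ᶜ) hg.stronglyMeasurable
      fun l hl => hk (Finset.mem_image.2 ⟨l, Finset.mem_univ l, hl⟩))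
    (fun i hi k hk => by
      obtain ⟨l, -, rfl⟩ := Finset.mem_image.1 hk
      exact hg.condExp_comp_incTuple_eq_zero hi l)
  have hterm : ∀ i ∈ incTuples m n,
      κ ^ (Finset.univ.image i).card *
        ∫ x, φ (g fun l => x (i l)) ∂iidMeasure ℕ P
      = κ ^ m * ∫ y, φ (g y) ∂iidMeasure (Fin m) P := fun i hi => by
    have hi' := measurePreserving_of_mem_incTuples (P := P) hi
    have hmap := integral_map hi'.aemeasurable (f := fun y => φ (g y))
      (hφ.continuous.comp_stronglyMeasurable hg.stronglyMeasurable).aestronglyMeasurable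
    rw [hi'.map_eq] at hmap
    rw [card_image_univ_of_mem_incTuples hi, hmap]
  calc _ ≤ _ := hsum
    _ = (incTuples m n).card * (κ ^ m * ∫ y, φ (g y) ∂iidMeasure (Fin m) P) := by
        rw [Finset.sum_congr rfl hterm, Finset.sum_const, nsmul_eq_mul]
    _ ≤ _ := by
        have hnonneg := mul_nonneg (pow_nonneg hφ.κ_nonneg m)
          (integral_nonneg (μ := iidMeasure (Fin m) P) fun y => hφ.nonneg (g y))
        gcongr
        exact card_incTuples_le m n

lemma IsSmoothGauge.rpow_mul_measure_exists_le_enorm_uStat_le (hφ : IsSmoothGauge φ r κ C)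
    (hg : IsCanonicalKernel (iidMeasure (Fin m) P) g)
    (hgr : MemLp g (ENNReal.ofReal r) (iidMeasure (Fin m) P)) (c : NNReal) (N : ℕ) :
    (c : ENNReal) ^ r *
      iidMeasure ℕ P {x | ∃ n ≤ N, c ≤ ‖uStat g Function.eval n x‖ₑ} ≤
      N.choose m * (ENNReal.ofReal κ ^ m * (ENNReal.ofReal C *
        ∫⁻ y, ‖g y‖ₑ ^ r ∂iidMeasure (Fin m) P)) := by
  refine (hφ.mul_measure_exists_le_enorm_le hg.martingale_uStat (memLp_uStat hgr) c N).trans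
    ((ENNReal.ofReal_le_ofReal (hφ.integral_uStat_le hg hgr N)).trans ?_)
  rw [ENNReal.ofReal_mul (Nat.cast_nonneg _), ENNReal.ofReal_natCast,
    ENNReal.ofReal_mul (pow_nonneg hφ.κ_nonneg m), ENNReal.ofReal_pow hφ.κ_nonneg]
  gcongr
  exact hφ.ofReal_integral_comp_le hgr

end UStatistic

section GeometricSums

open scoped ENNReal

lemma tsum_ite_mul_pow_le_of_decreasing (a q z : ℝ≥0∞) :
    ∑' k : ℕ, (if a * q ^ k ≤ z then a * q ^ k else 0) ≤ z * (1 - q)⁻¹ := by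
  by_cases hex : ∃ k, a * q ^ k ≤ z
  · obtain ⟨k₀, hk₀, hmin⟩ : ∃ k₀, a * q ^ k₀ ≤ z ∧ ∀ k < k₀, ¬ a * q ^ k ≤ z := by
      classical exact ⟨Nat.find hex, Nat.find_spec hex, fun _ => Nat.find_min hex⟩
    have hhead : ∑ k ∈ Finset.range k₀, (if a * q ^ k ≤ z then a * q ^ k else 0) = 0 :=
      Finset.sum_eq_zero fun k hk => if_neg (hmin k (Finset.mem_range.1 hk))
    rw [← Summable.sum_add_tsum_nat_add' (k := k₀) ENNReal.summable, hhead, zero_add]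
    calc ∑' k, (if a * q ^ (k + k₀) ≤ z then a * q ^ (k + k₀) else 0)
        ≤ ∑' k, a * q ^ k₀ * q ^ k := by
          refine ENNReal.tsum_le_tsum fun k => ?_
          rw [pow_add, mul_comm (q ^ k), ← mul_assoc]
          split_ifs <;> simp
      _ = a * q ^ k₀ * (1 - q)⁻¹ := by rw [ENNReal.tsum_mul_left, ENNReal.tsum_geometric]
      _ ≤ z * (1 - q)⁻¹ := by gcongr
  · push Not at hex
    simp [fun k => (hex k).not_ge]

lemma tsum_ite_mul_pow_le_of_increasing (a z : ℝ≥0∞) {q : ℝ≥0∞} (hq₀ : q ≠ 0) (hq : q ≠ ∞) :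
    ∑' k : ℕ, (if a * q ^ k ≤ z then a * q ^ k else 0) ≤ z * (1 - q⁻¹)⁻¹ := by
  refine ENNReal.tsum_le_of_sum_range_le fun n => ?_
  induction n with
  | zero => simp
  | succ n ih =>
    by_cases hn : a * q ^ n ≤ z
    · calc ∑ k ∈ Finset.range (n + 1), (if a * q ^ k ≤ z then a * q ^ k else 0)
          ≤ ∑ k ∈ Finset.range (n + 1), a * q ^ k :=
            Finset.sum_le_sum fun k _ => by split_ifs <;> simp
        _ = ∑ k ∈ Finset.range (n + 1), a * q ^ n * q⁻¹ ^ k := by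
            rw [← Finset.sum_range_reflect]
            refine Finset.sum_congr rfl fun k hk => ?_
            have hkn : k ≤ n := Finset.mem_range_succ_iff.1 hk
            have hsplit : q ^ n = q ^ (n - k) * q ^ k := by rw [← pow_add, Nat.sub_add_cancel hkn]
            rw [Nat.add_sub_cancel, hsplit, ← ENNReal.inv_pow, ← mul_assoc, mul_assoc _ _ (q ^ k)⁻¹,
              ENNReal.mul_inv_cancel (pow_ne_zero k hq₀) (ENNReal.pow_ne_top hq), mul_one]
        _ ≤ a * q ^ n * (1 - q⁻¹)⁻¹ := by
            rw [← Finset.mul_sum, ← ENNReal.tsum_geometric]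
            gcongr
            exact ENNReal.sum_le_tsum _
        _ ≤ z * (1 - q⁻¹)⁻¹ := by gcongr
    · rw [Finset.sum_range_succ, if_neg hn, add_zero]
      exact ih

variable {c A y : ℝ≥0∞} {p r s : ℝ}

lemma tsum_ite_le_rpow_neg_le (hc : c ≠ 0) (hA : A ≠ 0) (hs : 0 < s) (y : ℝ≥0∞) :
    ∑' k : ℕ, (if y ≤ c * A ^ k then (c * A ^ k) ^ (-s) else 0) ≤
      y ^ (-s) * (1 - A ^ (-s))⁻¹ := by
  refine le_trans (ENNReal.tsum_le_tsum fun k => ?_)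
    (tsum_ite_mul_pow_le_of_decreasing (c ^ (-s)) (A ^ (-s)) (y ^ (-s)))
  have hpow : (c * A ^ k) ^ (-s) = c ^ (-s) * (A ^ (-s)) ^ k := by
    rw [ENNReal.mul_rpow_of_ne_zero hc (pow_ne_zero k hA), ← ENNReal.rpow_natCast_mul,
      mul_comm (k : ℝ), ENNReal.rpow_mul_natCast]
  rw [← hpow]
  split_ifs with hy hle
  · exact le_rfl
  · rw [ENNReal.rpow_neg, ENNReal.rpow_neg] at hle
    exact absurd (ENNReal.inv_le_inv.2 (ENNReal.rpow_le_rpow hy hs.le)) hle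
  · exact zero_le
  · exact le_rfl

lemma tsum_ite_lt_rpow_le (c : ℝ≥0∞) (hA₀ : A ≠ 0) (hA : A ≠ ∞) (hs : 0 < s) (y : ℝ≥0∞) :
    ∑' k : ℕ, (if c * A ^ k < y then (c * A ^ k) ^ s else 0) ≤ y ^ s * (1 - A ^ (-s))⁻¹ := by
  rw [ENNReal.rpow_neg]
  refine le_trans (ENNReal.tsum_le_tsum fun k => ?_)
    (tsum_ite_mul_pow_le_of_increasing (c ^ s) (y ^ s) (by simp [hA₀, hA])
      (by simp [hA₀, hA]))
  have hpow : (c * A ^ k) ^ s = c ^ s * (A ^ s) ^ k := by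
    rw [ENNReal.mul_rpow_of_nonneg _ _ hs.le, ← ENNReal.rpow_natCast_mul, mul_comm (k : ℝ),
      ENNReal.rpow_mul_natCast]
  rw [← hpow]
  split_ifs with hy hle
  · exact le_rfl
  · exact absurd (ENNReal.rpow_le_rpow hy.le hs.le) hle
  · exact zero_le
  · exact le_rfl

lemma rpow_mul_min_div_le (hc₀ : c ≠ 0) (hc : c ≠ ∞) (hr : 0 ≤ r) (y : ℝ≥0∞) :
    c ^ p * min (y / c) ((y / c) ^ r) ≤
      y ^ r * (if y ≤ c then c ^ (-(r - p)) else 0) + y * (if c < y then c ^ (p - 1) else 0) := by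
  rcases le_or_gt y c with hy | hy
  · rw [if_pos hy, if_neg hy.not_gt, mul_zero, add_zero, neg_sub, ENNReal.rpow_sub _ _ hc₀ hc]
    refine (mul_le_mul_right (min_le_right _ _) _).trans_eq ?_
    rw [ENNReal.div_rpow_of_nonneg _ _ hr, ← mul_div_assoc, ← mul_div_assoc, mul_comm]
  · rw [if_neg hy.not_ge, if_pos hy, mul_zero, zero_add, ENNReal.rpow_sub _ _ hc₀ hc,
      ENNReal.rpow_one]
    refine (mul_le_mul_right (min_le_left _ _) _).trans_eq ?_
    rw [← mul_div_assoc, ← mul_div_assoc, mul_comm]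

lemma tsum_rpow_mul_min_div_le (hp : 1 < p) (hpr : p < r) (hc₀ : c ≠ 0) (hc : c ≠ ∞)
    (hA₀ : A ≠ 0) (hA : A ≠ ∞) (hy : y ≠ ∞) :
    ∑' k : ℕ, (c * A ^ k) ^ p * min (y / (c * A ^ k)) ((y / (c * A ^ k)) ^ r) ≤
      y ^ p * ((1 - A ^ (-(r - p)))⁻¹ + (1 - A ^ (-(p - 1)))⁻¹) := by
  rcases eq_or_ne y 0 with rfl | hy₀
  · simp
  have hpow_p : y ^ r * y ^ (-(r - p)) = y ^ p := by
    rw [← ENNReal.rpow_add _ _ hy₀ hy]; ring_nf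
  have hpow_p' : y * y ^ (p - 1) = y ^ p := by
    nth_rw 1 [← ENNReal.rpow_one y, ← ENNReal.rpow_add _ _ hy₀ hy, add_sub_cancel]
  calc ∑' k : ℕ, (c * A ^ k) ^ p * min (y / (c * A ^ k)) ((y / (c * A ^ k)) ^ r)
      ≤ ∑' k : ℕ, (y ^ r * (if y ≤ c * A ^ k then (c * A ^ k) ^ (-(r - p)) else 0) +
          y * (if c * A ^ k < y then (c * A ^ k) ^ (p - 1) else 0)) :=
        ENNReal.tsum_le_tsum fun k => rpow_mul_min_div_le (mul_ne_zero hc₀ (pow_ne_zero k hA₀))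
          (ENNReal.mul_ne_top hc (ENNReal.pow_ne_top hA)) (by linarith) y
    _ ≤ y ^ r * (y ^ (-(r - p)) * (1 - A ^ (-(r - p)))⁻¹) +
          y * (y ^ (p - 1) * (1 - A ^ (-(p - 1)))⁻¹) := by
        rw [ENNReal.tsum_add, ENNReal.tsum_mul_left, ENNReal.tsum_mul_left]
        gcongr
        · exact tsum_ite_le_rpow_neg_le hc₀ hA₀ (sub_pos.2 hpr) y
        · exact tsum_ite_lt_rpow_le c hA₀ hA (sub_pos.2 hp) y
    _ = y ^ p * ((1 - A ^ (-(r - p)))⁻¹ + (1 - A ^ (-(p - 1)))⁻¹) := by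
        rw [← mul_assoc, ← mul_assoc, hpow_p, hpow_p', mul_add]

end GeometricSums

section Truncation

open scoped ENNReal

lemma exists_isCanonicalKernel_memLp_of_memLp {ι B : Type*} [Fintype ι] [NormedAddCommGroup B]
    [NormedSpace ℝ B] [CompleteSpace B] {X : ι → Type*} [∀ i, MeasurableSpace (X i)]
    {P : ∀ i, Measure (X i)} [∀ i, IsProbabilityMeasure (P i)] {h f : (∀ i, X i) → B} {r : ℝ}
    (hh : IsCanonicalKernel (Measure.infinitePi P) h) (hr : 1 ≤ r) (hf : StronglyMeasurable f)
    (hfr : MemLp f (ENNReal.ofReal r) (Measure.infinitePi P)) :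
    ∃ g, IsCanonicalKernel (Measure.infinitePi P) g ∧
      MemLp g (ENNReal.ofReal r) (Measure.infinitePi P) ∧
      ∫⁻ x, ‖g x‖ₑ ^ r ∂Measure.infinitePi P ≤
        ((2 : ℝ≥0∞) ^ r) ^ Fintype.card ι * ∫⁻ x, ‖f x‖ₑ ^ r ∂Measure.infinitePi P ∧
      ∫⁻ x, ‖h x - g x‖ₑ ∂Measure.infinitePi P ≤
        2 ^ Fintype.card ι * ∫⁻ x, ‖h x - f x‖ₑ ∂Measure.infinitePi P := by
  classical
  set ν := Measure.infinitePi P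
  set 𝒢 : ι → MeasurableSpace (∀ i, X i) := fun i => cylinderEvents {i}ᶜ
  set l : List ι := Finset.univ.toList
  have hl : l.length = Fintype.card ι := Finset.length_toList _
  have h𝒢 : ∀ i, 𝒢 i ≤ MeasurableSpace.pi := fun i => cylinderEvents_le_pi
  have hfi : Integrable f ν := hfr.integrable (ENNReal.one_le_ofReal.2 hr)
  refine ⟨hoeffdingProjection ν 𝒢 l f,
    ⟨stronglyMeasurable_hoeffdingProjection h𝒢 hf l, integrable_hoeffdingProjection hfi l,
      fun i => condExp_hoeffdingProjection h𝒢 condExp_cylinderEvents_comm hfi (by simp [l])⟩,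
    memLp_hoeffdingProjection (ENNReal.one_le_ofReal.2 hr) hfr l, ?_, ?_⟩
  · rw [← hl]
    exact lintegral_enorm_rpow_hoeffdingProjection_le hr hfr l
  · have hsub : ∫⁻ x, ‖h x - hoeffdingProjection ν 𝒢 l f x‖ₑ ∂ν =
        ∫⁻ x, ‖hoeffdingProjection ν 𝒢 l (h - f) x‖ₑ ∂ν := by
      refine lintegral_congr_ae ?_
      filter_upwards [hoeffdingProjection_sub_ae_eq (l := l) hh.integrable hfi
        fun i _ => hh.condExp_eq_zero i] with x hx
      rw [hx, Pi.sub_apply]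
    have hL1 := lintegral_enorm_rpow_hoeffdingProjection_le (𝒢 := 𝒢) (q := 1) le_rfl
      (by simpa using memLp_one_iff_integrable.2 (hh.integrable.sub hfi)) l
    simp only [ENNReal.rpow_one, hl, Pi.sub_apply] at hL1
    rw [hsub]
    exact hL1

variable {S B : Type*} [MeasurableSpace S] {P : Measure S} [IsProbabilityMeasure P]
  [NormedAddCommGroup B]

lemma enorm_rpow_indicator_le {X : Type*} {r : ℝ} (hr : 1 ≤ r) (h : X → B) {c : NNReal} (hc : c ≠ 0)
    (x : X) :
    ‖{y | ‖h y‖ₑ ≤ c}.indicator h x‖ₑ ^ r ≤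
      (c : ℝ≥0∞) ^ r * min (‖h x‖ₑ / c) ((‖h x‖ₑ / c) ^ r) := by
  have hr₀ : 0 < r := zero_lt_one.trans_le hr
  have hc' : (c : ℝ≥0∞) ≠ 0 := ENNReal.coe_ne_zero.2 hc
  by_cases hx : ‖h x‖ₑ ≤ c
  · have hone : ‖h x‖ₑ / c ≤ 1 := ENNReal.div_le_of_le_mul (by rwa [one_mul])
    rw [Set.indicator_of_mem (s := {y | ‖h y‖ₑ ≤ c}) hx,
      min_eq_right (ENNReal.rpow_le_self_of_le_one hone hr),
      ← ENNReal.mul_rpow_of_nonneg _ _ hr₀.le, ENNReal.mul_div_cancel hc' ENNReal.coe_ne_top]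
  · rw [Set.indicator_of_notMem (s := {y | ‖h y‖ₑ ≤ c}) hx, enorm_zero,
      ENNReal.zero_rpow_of_pos hr₀]
    exact zero_le

lemma enorm_sub_indicator_le {X : Type*} {r : ℝ} (hr : 1 ≤ r) (h : X → B) {c : NNReal} (hc : c ≠ 0)
    (x : X) :
    ‖h x - {y | ‖h y‖ₑ ≤ c}.indicator h x‖ₑ ≤ c * min (‖h x‖ₑ / c) ((‖h x‖ₑ / c) ^ r) := by
  have hc' : (c : ℝ≥0∞) ≠ 0 := ENNReal.coe_ne_zero.2 hc
  by_cases hx : ‖h x‖ₑ ≤ c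
  · rw [Set.indicator_of_mem (s := {y | ‖h y‖ₑ ≤ c}) hx, sub_self, enorm_zero]
    exact zero_le
  · have hone : 1 ≤ ‖h x‖ₑ / c := by
      rw [ENNReal.le_div_iff_mul_le (.inl hc') (.inl ENNReal.coe_ne_top), one_mul]
      exact (not_le.1 hx).le
    rw [Set.indicator_of_notMem (s := {y | ‖h y‖ₑ ≤ c}) hx, sub_zero,
      min_eq_left (ENNReal.le_rpow_self_of_one_le hone hr),
      ENNReal.mul_div_cancel hc' ENNReal.coe_ne_top]

variable [NormedSpace ℝ B] [CompleteSpace B] {φ : B → ℝ} {r κ C : ℝ} {m : ℕ}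
  {h : (Fin m → S) → B}

lemma exists_isCanonicalKernel_truncation (hh : IsCanonicalKernel (iidMeasure (Fin m) P) h)
    (hr : 1 ≤ r) {c : NNReal} (hc : c ≠ 0) :
    ∃ g, IsCanonicalKernel (iidMeasure (Fin m) P) g ∧
      MemLp g (ENNReal.ofReal r) (iidMeasure (Fin m) P) ∧
      ∫⁻ y, ‖g y‖ₑ ^ r ∂iidMeasure (Fin m) P ≤ ((2 : ℝ≥0∞) ^ r) ^ m * ((c : ℝ≥0∞) ^ r *
        ∫⁻ y, min (‖h y‖ₑ / c) ((‖h y‖ₑ / c) ^ r) ∂iidMeasure (Fin m) P) ∧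
      ∫⁻ y, ‖h y - g y‖ₑ ∂iidMeasure (Fin m) P ≤
        2 ^ m * (c * ∫⁻ y, min (‖h y‖ₑ / c) ((‖h y‖ₑ / c) ^ r) ∂iidMeasure (Fin m) P) := by
  have hmeas : MeasurableSet {y | ‖h y‖ₑ ≤ c} :=
    hh.stronglyMeasurable.enorm measurableSet_Iic
  have hf : StronglyMeasurable ({y | ‖h y‖ₑ ≤ c}.indicator h) :=
    hh.stronglyMeasurable.indicator hmeas
  have hfr : MemLp ({y | ‖h y‖ₑ ≤ c}.indicator h) (ENNReal.ofReal r) (iidMeasure (Fin m) P) := by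
    refine MemLp.of_bound hf.aestronglyMeasurable c (ae_of_all _ fun y => ?_)
    rw [norm_indicator_eq_indicator_norm]
    refine Set.indicator_apply_le' (fun hy => ?_) fun _ => c.coe_nonneg
    exact NNReal.coe_le_coe.2 (by simpa [enorm_eq_nnnorm] using hy)
  obtain ⟨g, hg, hgr, hg_r, hg_one⟩ := exists_isCanonicalKernel_memLp_of_memLp hh hr hf hfr
  rw [Fintype.card_fin] at hg_r hg_one
  have hI : Measurable fun y => min (‖h y‖ₑ / c) ((‖h y‖ₑ / c) ^ r) :=
    (hh.stronglyMeasurable.enorm.div_const _).min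
      ((hh.stronglyMeasurable.enorm.div_const _).pow_const r)
  refine ⟨g, hg, hgr, hg_r.trans ?_, hg_one.trans ?_⟩
  · rw [← lintegral_const_mul _ hI]
    gcongr
    exact enorm_rpow_indicator_le hr h hc _
  · rw [← lintegral_const_mul _ hI]
    gcongr
    exact enorm_sub_indicator_le hr h hc _

lemma IsSmoothGauge.measure_exists_lt_enorm_uStat_le (hφ : IsSmoothGauge φ r κ C)
    (hh : IsCanonicalKernel (iidMeasure (Fin m) P) h) {c : NNReal} (hc : c ≠ 0) (N : ℕ) :
    iidMeasure ℕ P {x | ∃ n ≤ N, 2 * c < ‖uStat h Function.eval n x‖ₑ} ≤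
      (ENNReal.ofReal C * (ENNReal.ofReal κ * 2 ^ r) ^ m + 2 ^ m) *
        (N.choose m * ∫⁻ y, min (‖h y‖ₑ / c) ((‖h y‖ₑ / c) ^ r) ∂iidMeasure (Fin m) P) := by
  have hc' : (c : ℝ≥0∞) ≠ 0 := ENNReal.coe_ne_zero.2 hc
  obtain ⟨g, hg, hgr, hg_r, hg_one⟩ := exists_isCanonicalKernel_truncation hh hφ.one_le hc
  set ν := iidMeasure ℕ P
  set I := ∫⁻ y, min (‖h y‖ₑ / c) ((‖h y‖ₑ / c) ^ r) ∂iidMeasure (Fin m) P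
  have hcover : {x : ℕ → S | ∃ n ≤ N, 2 * c < ‖uStat h Function.eval n x‖ₑ} ⊆
      {x | ∃ n ≤ N, c ≤ ‖uStat g Function.eval n x‖ₑ} ∪
        {x | ∃ n ≤ N, c ≤ ‖uStat (h - g) Function.eval n x‖ₑ} := by
    rintro x ⟨n, hn, hx⟩
    have hadd : uStat h Function.eval n x =
        uStat g Function.eval n x + uStat (h - g) Function.eval n x := by
      simp only [uStat, ← Finset.sum_add_distrib, Pi.sub_apply, add_sub_cancel]
    by_contra! hlt
    simp only [Set.mem_union, Set.mem_ofPred_eq, not_or, not_exists, not_and, not_le] at hlt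
    refine hx.not_ge ?_
    rw [hadd, two_mul]
    exact (enorm_add_le _ _).trans (add_le_add (hlt.1 n hn).le (hlt.2 n hn).le)
  have htrunc : ν {x | ∃ n ≤ N, c ≤ ‖uStat g Function.eval n x‖ₑ} ≤
      ENNReal.ofReal C * (ENNReal.ofReal κ * 2 ^ r) ^ m * (N.choose m * I) := by
    refine (ENNReal.mul_le_mul_iff_right (a := (c : ℝ≥0∞) ^ r) (by simp [hc']) (by simp [hc'])).1 ?_
    refine (hφ.rpow_mul_measure_exists_le_enorm_uStat_le hg hgr c N).trans ?_
    refine (by gcongr :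
      _ ≤ _ * (_ * (_ * (((2 : ℝ≥0∞) ^ r) ^ m * ((c : ℝ≥0∞) ^ r * I))))).trans_eq ?_
    ring
  have hrest : ν {x | ∃ n ≤ N, c ≤ ‖uStat (h - g) Function.eval n x‖ₑ} ≤
      2 ^ m * (N.choose m * I) := by
    refine (ENNReal.mul_le_mul_iff_right (a := (c : ℝ≥0∞)) hc' ENNReal.coe_ne_top).1 ?_
    refine (mul_measure_exists_le_enorm_uStat_le
      (hh.stronglyMeasurable.sub hg.stronglyMeasurable) c N).trans ?_
    refine (by gcongr; exact hg_one : _ ≤ _ * (2 ^ m * (c * I))).trans_eq ?_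
    ring
  calc _ ≤ _ := (measure_mono hcover).trans (measure_union_le _ _)
    _ ≤ _ := add_le_add htrunc hrest
    _ = _ := by ring

end Truncation

section SummedTails

open scoped ENNReal

lemma ofReal_pow_div_factorial_le_exp {a : ℝ} (ha : 0 ≤ a) (m : ℕ) :
    ENNReal.ofReal a ^ m / m.factorial ≤ ENNReal.ofReal (Real.exp a) := by
  rw [← ENNReal.ofReal_pow ha, ← ENNReal.ofReal_natCast m.factorial,
    ← ENNReal.ofReal_div_of_pos (by positivity)]
  exact ENNReal.ofReal_le_ofReal (Real.pow_div_factorial_le_exp a ha m)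

lemma blockFactor_mul_le_exp {κ : ℝ} (hκ : 0 ≤ κ) (r C : ℝ) (m : ℕ) :
    (ENNReal.ofReal C * (ENNReal.ofReal κ * 2 ^ r) ^ m + 2 ^ m) * (2 ^ m / m.factorial) ≤
      ENNReal.ofReal C * ENNReal.ofReal (Real.exp (2 * (κ * 2 ^ r))) +
        ENNReal.ofReal (Real.exp 4) := by
  have htwo_rpow : ENNReal.ofReal (2 * (κ * 2 ^ r)) = 2 * (ENNReal.ofReal κ * 2 ^ r) := by
    rw [ENNReal.ofReal_mul zero_le_two, ENNReal.ofReal_mul hκ,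
      ← ENNReal.ofReal_rpow_of_pos two_pos, ENNReal.ofReal_ofNat]
  have hfour : ENNReal.ofReal 4 = 2 * 2 := by rw [ENNReal.ofReal_ofNat]; norm_num
  calc _ = ENNReal.ofReal C * (ENNReal.ofReal (2 * (κ * 2 ^ r)) ^ m / m.factorial) +
        ENNReal.ofReal 4 ^ m / m.factorial := by
        rw [htwo_rpow, hfour, mul_pow 2 (_ * _), mul_pow 2 2]
        simp only [div_eq_mul_inv]
        ring
    _ ≤ _ := by
        gcongr
        · exact ofReal_pow_div_factorial_le_exp (by positivity) m
        · exact ofReal_pow_div_factorial_le_exp (by norm_num) m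

lemma choose_two_pow_succ_le (m k : ℕ) :
    ((2 ^ (k + 1)).choose m : ℝ≥0∞) ≤ 2 ^ m / m.factorial * (2 ^ m) ^ k := by
  have hle : ((2 ^ (k + 1)).choose m : ℝ) ≤ (2 ^ (k + 1)) ^ m / m.factorial := by
    simpa using Nat.choose_le_pow_div (α := ℝ) m (2 ^ (k + 1))
  calc ((2 ^ (k + 1)).choose m : ℝ≥0∞) = ENNReal.ofReal ((2 ^ (k + 1)).choose m : ℝ) :=
        (ENNReal.ofReal_natCast _).symm
    _ ≤ ENNReal.ofReal ((2 ^ (k + 1)) ^ m / m.factorial) := ENNReal.ofReal_le_ofReal hle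
    _ = (2 ^ (k + 1)) ^ m / m.factorial := by
        rw [ENNReal.ofReal_div_of_pos (by positivity), ENNReal.ofReal_natCast,
          ENNReal.ofReal_pow (by positivity), ENNReal.ofReal_pow (by positivity),
          ENNReal.ofReal_ofNat]
    _ = 2 ^ m / m.factorial * (2 ^ m) ^ k := by
        rw [← pow_mul, ← pow_mul, ENNReal.mul_div_right_comm.symm, ← pow_add]
        ring_nf

lemma two_rpow_div_rpow {p : ℝ} (hp : p ≠ 0) (m : ℕ) :
    ((2 : ℝ≥0∞) ^ ((m : ℝ) / p)) ^ p = 2 ^ m := by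
  rw [← ENNReal.rpow_mul, div_mul_cancel₀ _ hp, ENNReal.rpow_natCast]

lemma inv_one_sub_rpow_neg_le {a b : ℝ≥0∞} {s : ℝ} (hab : a ≤ b) (hs : 0 ≤ s) :
    (1 - b ^ (-s))⁻¹ ≤ (1 - a ^ (-s))⁻¹ := by
  rw [ENNReal.rpow_neg, ENNReal.rpow_neg]
  gcongr

/-- The constant of the weak-type inequality, in terms of the exponents `p < r` and the parameters
of the smooth gauge. It bounds, uniformly in `m ≥ 1`, the factor `2 ^ m / m.factorial` of the
binomial coefficients together with the `m`-th powers of the block estimate and with the geometric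
series of ratio `2 ^ (m / p)`. -/
noncomputable def tailConstant (p r κ C : ℝ) : ℝ≥0∞ :=
  2 ^ p * ((ENNReal.ofReal C * ENNReal.ofReal (Real.exp (2 * (κ * 2 ^ r))) +
      ENNReal.ofReal (Real.exp 4)) *
    ((1 - ((2 : ℝ≥0∞) ^ p⁻¹) ^ (-(r - p)))⁻¹ + (1 - ((2 : ℝ≥0∞) ^ p⁻¹) ^ (-(p - 1)))⁻¹))

lemma tailConstant_ne_top {p r : ℝ} (hp : 1 < p) (hpr : p < r) (κ C : ℝ) :
    tailConstant p r κ C ≠ ∞ := by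
  have hbase : 1 < (2 : ℝ≥0∞) ^ p⁻¹ :=
    ENNReal.one_lt_rpow ENNReal.one_lt_two (inv_pos.2 (zero_lt_one.trans hp))
  have hgeom : ∀ s : ℝ, 0 < s → (1 - ((2 : ℝ≥0∞) ^ p⁻¹) ^ (-s))⁻¹ ≠ ∞ := fun s hs =>
    ENNReal.inv_ne_top.2 (tsub_pos_of_lt
      (ENNReal.rpow_lt_one_of_one_lt_of_neg hbase (neg_lt_zero.2 hs))).ne'
  have hr := hgeom (r - p) (sub_pos.2 hpr)
  have hp' := hgeom (p - 1) (sub_pos.2 hp)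
  have hpow : (2 : ℝ≥0∞) ^ p ≠ ∞ := by simp
  rw [tailConstant]
  finiteness

variable {S B : Type*} [MeasurableSpace S] {P : Measure S} [IsProbabilityMeasure P]
  [NormedAddCommGroup B] {m : ℕ} {h : (Fin m → S) → B} {p r : ℝ}

lemma tsum_lintegral_min_le {X : Type*} {mX : MeasurableSpace X} {ν : Measure X} {h : X → B}
    (hh : StronglyMeasurable h) (hp : 1 < p) (hpr : p < r) (hm : 1 ≤ m) {c : ℝ≥0∞}
    (hc₀ : c ≠ 0) (hc : c ≠ ∞) :
    c ^ p * ∑' k : ℕ, (2 ^ m) ^ k * ∫⁻ y, min (‖h y‖ₑ / (c * ((2 : ℝ≥0∞) ^ ((m : ℝ) / p)) ^ k))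
        ((‖h y‖ₑ / (c * ((2 : ℝ≥0∞) ^ ((m : ℝ) / p)) ^ k)) ^ r) ∂ν ≤
      ((1 - ((2 : ℝ≥0∞) ^ p⁻¹) ^ (-(r - p)))⁻¹ + (1 - ((2 : ℝ≥0∞) ^ p⁻¹) ^ (-(p - 1)))⁻¹) *
        ∫⁻ y, ‖h y‖ₑ ^ p ∂ν := by
  have hp₀ : 0 < p := zero_lt_one.trans hp
  set A := (2 : ℝ≥0∞) ^ ((m : ℝ) / p) with hA_def
  have hA₀ : A ≠ 0 := by simp [hA_def]
  have hA : A ≠ ∞ := by simp [hA_def]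
  have hA_ge : (2 : ℝ≥0∞) ^ p⁻¹ ≤ A := by
    refine ENNReal.rpow_le_rpow_of_exponent_le one_le_two ?_
    rw [← one_div]
    gcongr
    exact_mod_cast hm
  have hscale : ∀ k : ℕ, c ^ p * (2 ^ m) ^ k = (c * A ^ k) ^ p := fun k => by
    rw [ENNReal.mul_rpow_of_nonneg _ _ hp₀.le, ← two_rpow_div_rpow hp₀.ne', ← hA_def,
      ← ENNReal.rpow_natCast_mul, ← ENNReal.rpow_mul_natCast, mul_comm (k : ℝ)]
  have hmeas : ∀ k : ℕ, Measurable fun y =>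
      min (‖h y‖ₑ / (c * A ^ k)) ((‖h y‖ₑ / (c * A ^ k)) ^ r) := fun k =>
    (hh.enorm.div_const _).min ((hh.enorm.div_const _).pow_const r)
  simp_rw [← ENNReal.tsum_mul_left, ← mul_assoc, hscale, ← lintegral_const_mul _ (hmeas _)]
  rw [← lintegral_tsum fun k => ((hmeas k).const_mul _).aemeasurable, mul_comm,
    ← lintegral_mul_const _ (hh.enorm.pow_const p)]
  refine lintegral_mono fun y =>
    (tsum_rpow_mul_min_div_le hp hpr hc₀ hc hA₀ hA enorm_ne_top).trans
      (mul_le_mul_right (add_le_add (inv_one_sub_rpow_neg_le hA_ge (sub_nonneg.2 hpr.le))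
        (inv_one_sub_rpow_neg_le hA_ge (sub_nonneg.2 hp.le))) _)

variable [NormedSpace ℝ B] [CompleteSpace B] {φ : B → ℝ} {κ C : ℝ}

lemma IsSmoothGauge.rpow_mul_tsum_measure_exists_lt_enorm_uStat_le (hφ : IsSmoothGauge φ r κ C)
    (hh : IsCanonicalKernel (iidMeasure (Fin m) P) h) (hp : 1 < p) (hpr : p < r) (hm : 1 ≤ m)
    {t : ℝ≥0∞} (ht₀ : t ≠ 0) (ht : t ≠ ∞) :
    t ^ p * ∑' k : ℕ, iidMeasure ℕ P {x | ∃ n ≤ 2 ^ (k + 1),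
        t * ((2 : ℝ≥0∞) ^ ((m : ℝ) / p)) ^ k < ‖uStat h Function.eval n x‖ₑ} ≤
      tailConstant p r κ C * ∫⁻ y, ‖h y‖ₑ ^ p ∂iidMeasure (Fin m) P := by
  set A := (2 : ℝ≥0∞) ^ ((m : ℝ) / p) with hA_def
  set L := ENNReal.ofReal C * (ENNReal.ofReal κ * 2 ^ r) ^ m + 2 ^ m
  obtain ⟨c, rfl⟩ : ∃ c, t = 2 * c := ⟨t / 2, (ENNReal.mul_div_cancel two_ne_zero (by simp)).symm⟩
  have hc₀ : c ≠ 0 := right_ne_zero_of_mul ht₀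
  have hc : c ≠ ∞ := fun h => ht (by simp [h])
  set I : ℕ → ℝ≥0∞ := fun k => ∫⁻ y, min (‖h y‖ₑ / (c * A ^ k)) ((‖h y‖ₑ / (c * A ^ k)) ^ r)
    ∂iidMeasure (Fin m) P
  have hblock : ∀ k : ℕ, iidMeasure ℕ P {x | ∃ n ≤ 2 ^ (k + 1),
      2 * c * A ^ k < ‖uStat h Function.eval n x‖ₑ} ≤
        L * (2 ^ m / m.factorial) * ((2 ^ m) ^ k * I k) := by
    intro k
    obtain ⟨d, hd⟩ : ∃ d : NNReal, (d : ℝ≥0∞) = c * A ^ k :=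
      ⟨_, ENNReal.coe_toNNReal (by finiteness [hA_def])⟩
    have hd₀ : d ≠ 0 := by
      rw [← ENNReal.coe_ne_zero, hd]
      simp [hc₀, hA_def]
    have hle := hφ.measure_exists_lt_enorm_uStat_le hh hd₀ (2 ^ (k + 1))
    rw [hd, ← mul_assoc 2 c] at hle
    calc _ ≤ L * ((2 ^ (k + 1)).choose m * I k) := hle
      _ ≤ L * (2 ^ m / m.factorial * (2 ^ m) ^ k * I k) := by
          gcongr
          exact choose_two_pow_succ_le m k
      _ = _ := by ring
  calc (2 * c) ^ p * ∑' k : ℕ, iidMeasure ℕ P {x | ∃ n ≤ 2 ^ (k + 1),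
        2 * c * A ^ k < ‖uStat h Function.eval n x‖ₑ}
      ≤ (2 * c) ^ p * ∑' k : ℕ, L * (2 ^ m / m.factorial) * ((2 ^ m) ^ k * I k) := by
        gcongr with k
        exact hblock k
    _ = 2 ^ p * (L * (2 ^ m / m.factorial) * (c ^ p * ∑' k : ℕ, (2 ^ m) ^ k * I k)) := by
        rw [ENNReal.tsum_mul_left, ENNReal.mul_rpow_of_nonneg _ _ (by linarith)]
        ring
    _ ≤ 2 ^ p * (_ * (_ * _)) := mul_le_mul_right (mul_le_mul'
        (blockFactor_mul_le_exp hφ.κ_nonneg r C m)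
        (tsum_lintegral_min_le hh.stronglyMeasurable hp hpr hm hc₀ hc)) _
    _ = _ := by rw [tailConstant]; ring

end SummedTails

section Transfer

lemma sigmaWithout_eq_comap_cylinderEvents {Ω S : Type*} [MeasurableSpace S] {m : ℕ}
    (ξ : ℕ → Ω → S) (l₀ : Fin m) :
    sigmaWithout ξ l₀ = (cylinderEvents {l₀}ᶜ).comap fun ω (l : Fin m) => ξ l ω := by
  rw [comap_cylinderEvents, sigmaWithout, MeasurableSpace.pi, MeasurableSpace.comap_iSup,
    ← iSup_subtype'']
  simp only [MeasurableSpace.comap_comp]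
  rfl

variable {Ω S B : Type*} [MeasurableSpace Ω] [MeasurableSpace S] {μ : Measure Ω}
  {ξ : ℕ → Ω → S} {m : ℕ}

lemma IsIIDSequence.measurePreserving (hξ : IsIIDSequence ξ μ) :
    MeasurePreserving (fun ω i => ξ i ω) μ (iidMeasure ℕ (μ.map (ξ 0))) := by
  refine ⟨measurable_pi_iff.2 hξ.measurable, ?_⟩
  rw [hξ.indep.map_fun_eq_infinitePi_map hξ.measurable]
  simp only [fun i => (hξ.identDistrib i).map_eq]

variable [IsProbabilityMeasure μ]

lemma IsIIDSequence.isProbabilityMeasure_map (hξ : IsIIDSequence ξ μ) :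
    IsProbabilityMeasure (μ.map (ξ 0)) :=
  Measure.isProbabilityMeasure_map (hξ.measurable 0).aemeasurable

lemma IsIIDSequence.measurePreserving_fin (hξ : IsIIDSequence ξ μ) (m : ℕ) :
    MeasurePreserving (fun ω (l : Fin m) => ξ l ω) μ (iidMeasure (Fin m) (μ.map (ξ 0))) :=
  have := hξ.isProbabilityMeasure_map
  (measurePreserving_comp_of_injective (fun _ => μ.map (ξ 0)) Fin.val_injective).comp
    hξ.measurePreserving

variable [NormedAddCommGroup B] [NormedSpace ℝ B] [CompleteSpace B] {h : (Fin m → S) → B}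

lemma IsDegenerated.isCanonicalKernel (hdeg : IsDegenerated h ξ μ) (hξ : IsIIDSequence ξ μ)
    (hh : StronglyMeasurable h) : IsCanonicalKernel (iidMeasure (Fin m) (μ.map (ξ 0))) h := by
  have := hξ.isProbabilityMeasure_map
  have hY := hξ.measurePreserving_fin m
  have hint : Integrable h (iidMeasure (Fin m) (μ.map (ξ 0))) :=
    (hY.integrable_comp hh.aestronglyMeasurable).1 hdeg.1
  refine ⟨hh, hint, fun l => ?_⟩
  have hcomp := condExp_comp_comap_ae_eq hY
    (cylinderEvents_le_pi (X := fun _ => S) (Δ := {l}ᶜ)) hint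
  rw [← sigmaWithout_eq_comap_cylinderEvents] at hcomp
  have hmeas : MeasurableSet {y | ((iidMeasure (Fin m) (μ.map (ξ 0)))[h | cylinderEvents {l}ᶜ]) y =
      (0 : B)} :=
    (stronglyMeasurable_condExp.mono cylinderEvents_le_pi).measurableSet_eq_fun
      stronglyMeasurable_const
  have hzero := (ae_map_iff hY.aemeasurable hmeas).2 (hcomp.symm.trans (hdeg.2 l))
  rwa [hY.map_eq] at hzero

open scoped ENNReal

lemma IsSmoothGauge.rpow_mul_tsum_measure_le_of_isDegenerated {φ : B → ℝ} {p r κ C : ℝ}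
    (hφ : IsSmoothGauge φ r κ C) (hξ : IsIIDSequence ξ μ) (hh : StronglyMeasurable h)
    (hdeg : IsDegenerated h ξ μ) (hp : 1 < p) (hpr : p < r) (hm : 1 ≤ m)
    {t : ℝ≥0∞} (ht₀ : t ≠ 0) (ht : t ≠ ∞) :
    t ^ p * ∑' k : ℕ, μ {ω | ∃ n ≤ 2 ^ (k + 1),
        t * ((2 : ℝ≥0∞) ^ ((m : ℝ) / p)) ^ k < ‖uStat h ξ n ω‖ₑ} ≤
      tailConstant p r κ C * ∫⁻ ω, ‖kernelRV h ξ ω‖ₑ ^ p ∂μ := by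
  have := hξ.isProbabilityMeasure_map
  have hmoment : ∫⁻ ω, ‖kernelRV h ξ ω‖ₑ ^ p ∂μ =
      ∫⁻ y, ‖h y‖ₑ ^ p ∂iidMeasure (Fin m) (μ.map (ξ 0)) :=
    (hξ.measurePreserving_fin m).lintegral_comp (hh.enorm.pow_const p)
  rw [hmoment]
  refine le_trans ?_ (hφ.rpow_mul_tsum_measure_exists_lt_enorm_uStat_le
    (hdeg.isCanonicalKernel hξ hh) hp hpr hm ht₀ ht)
  gcongr with k
  exact hξ.measurePreserving.measure_preimage_le _

end Transfer

section DyadicBlocks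

open scoped ENNReal

lemma exists_dyadic_mul_pow_lt {u : ℕ → ℝ≥0∞} {a : ℝ} (ha : 0 ≤ a) {t : ℝ≥0∞} {n : ℕ} (hn : n ≠ 0)
    (hu : t * (n : ℝ≥0∞) ^ a < u n) :
    ∃ n' ≤ 2 ^ (Nat.log 2 n + 1), t * ((2 : ℝ≥0∞) ^ a) ^ Nat.log 2 n < u n' := by
  refine ⟨n, (Nat.lt_pow_succ_log_self one_lt_two n).le, lt_of_le_of_lt ?_ hu⟩
  rw [← ENNReal.rpow_mul_natCast, mul_comm a, ENNReal.rpow_natCast_mul]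
  gcongr
  exact_mod_cast Nat.pow_log_le_self 2 hn

variable {Ω B : Type*} [NormedAddCommGroup B] {mΩ : MeasurableSpace Ω} {μ : Measure Ω}
  {u : ℕ → Ω → B} {a : ℝ}

lemma ofReal_one_div_rpow_mul_norm {n : ℕ} (hn : n ≠ 0) (a : ℝ) (x : B) :
    ENNReal.ofReal (1 / (n : ℝ) ^ a * ‖x‖) = ‖x‖ₑ / (n : ℝ≥0∞) ^ a := by
  have hn' : (0 : ℝ) < n := by positivity
  rw [one_div_mul_eq_div, ENNReal.ofReal_div_of_pos (by positivity), ofReal_norm,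
    ← ENNReal.ofReal_rpow_of_pos hn', ENNReal.ofReal_natCast]

lemma measure_lt_iSup_one_div_rpow_mul_norm_le_tsum (ha : 0 ≤ a) {m : ℕ} (hm : 1 ≤ m) (t : ℝ≥0∞) :
    μ {ω | t < ⨆ (n : ℕ) (_ : m ≤ n), ENNReal.ofReal (1 / (n : ℝ) ^ a * ‖u n ω‖)} ≤
      ∑' k : ℕ, μ {ω | ∃ n ≤ 2 ^ (k + 1), t * ((2 : ℝ≥0∞) ^ a) ^ k < ‖u n ω‖ₑ} := by
  refine (measure_mono fun ω hω => ?_).trans (measure_iUnion_le _)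
  obtain ⟨n, hn, hlt⟩ : ∃ n, ∃ _ : m ≤ n, t < ENNReal.ofReal (1 / (n : ℝ) ^ a * ‖u n ω‖) := by
    simpa only [Set.mem_ofPred_eq, lt_iSup_iff] using hω
  have hn₀ : n ≠ 0 := by omega
  rw [ofReal_one_div_rpow_mul_norm hn₀] at hlt
  exact Set.mem_iUnion.2 ⟨Nat.log 2 n, exists_dyadic_mul_pow_lt (u := fun n => ‖u n ω‖ₑ) ha hn₀
    (ENNReal.mul_lt_of_lt_div hlt)⟩

lemma ae_eventually_enorm_le_mul_rpow (ha : 0 ≤ a) {t : ℝ≥0∞}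
    (hsum : ∑' k : ℕ, μ {ω | ∃ n ≤ 2 ^ (k + 1), t * ((2 : ℝ≥0∞) ^ a) ^ k < ‖u n ω‖ₑ} ≠ ∞) :
    ∀ᵐ ω ∂μ, ∀ᶠ n : ℕ in atTop, ‖u n ω‖ₑ ≤ t * (n : ℝ≥0∞) ^ a := by
  filter_upwards [ae_eventually_notMem hsum] with ω hω
  have hlog : Tendsto (Nat.log 2) atTop atTop :=
    tendsto_atTop_atTop.2 fun k => ⟨2 ^ k, fun n hn => Nat.le_log_of_pow_le one_lt_two hn⟩
  filter_upwards [hlog.eventually hω, eventually_ne_atTop 0] with n hn hn₀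
  exact le_of_not_gt fun hlt =>
    hn (exists_dyadic_mul_pow_lt (u := fun n => ‖u n ω‖ₑ) ha hn₀ hlt)

lemma ae_tendsto_one_div_rpow_mul_norm_zero (ha : 0 ≤ a) (hsum : ∀ t : ℝ≥0∞, t ≠ 0 → t ≠ ∞ →
      ∑' k : ℕ, μ {ω | ∃ n ≤ 2 ^ (k + 1), t * ((2 : ℝ≥0∞) ^ a) ^ k < ‖u n ω‖ₑ} ≠ ∞) :
    ∀ᵐ ω ∂μ, Tendsto (fun n : ℕ => 1 / (n : ℝ) ^ a * ‖u n ω‖) atTop (𝓝 0) := by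
  have hall : ∀ᵐ ω ∂μ, ∀ j : ℕ, ∀ᶠ n : ℕ in atTop, ‖u n ω‖ₑ ≤ 2⁻¹ ^ j * (n : ℝ≥0∞) ^ a :=
    ae_all_iff.2 fun j => ae_eventually_enorm_le_mul_rpow ha (hsum _ (by simp) (by simp))
  filter_upwards [hall] with ω hω
  have hnonneg : ∀ n : ℕ, 0 ≤ 1 / (n : ℝ) ^ a * ‖u n ω‖ := fun n => by positivity
  have hlim : Tendsto (fun n : ℕ => ENNReal.ofReal (1 / (n : ℝ) ^ a * ‖u n ω‖)) atTop (𝓝 0) := by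
    refine ENNReal.tendsto_nhds_zero.2 fun ε hε => ?_
    obtain ⟨j, hj⟩ := ENNReal.exists_inv_two_pow_lt hε.ne'
    filter_upwards [hω j, eventually_ne_atTop 0] with n hn hn₀
    rw [ofReal_one_div_rpow_mul_norm hn₀]
    exact ENNReal.div_le_of_le_mul (hn.trans (by gcongr))
  simpa only [Function.comp_def, ENNReal.toReal_ofReal (hnonneg _), ENNReal.toReal_zero] using
    (ENNReal.tendsto_toReal ENNReal.zero_ne_top).comp hlim

end DyadicBlocks

theorem mainTheorem5_general {B : Type*} [NormedAddCommGroup B] [NormedSpace ℝ B] [CompleteSpace B]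
    (r : ℝ) (hr₂ : r ≤ 2) (hB : IsRSmooth B r) (p : ℝ) (hp₁ : 1 < p) (hpr : p < r) :
    ∃ K : ℝ, 0 < K ∧
      ∀ (m : ℕ), 1 ≤ m →
      ∀ (Ω : Type*) [MeasurableSpace Ω] (μ : Measure Ω) [IsProbabilityMeasure μ]
        (S : Type*) [MeasurableSpace S]
        (ξ : ℕ → Ω → S) (h : (Fin m → S) → B),
        IsIIDSequence ξ μ → StronglyMeasurable h → IsDegenerated h ξ μ →
        (⨆ (t : ℝ) (_ : 0 < t), ENNReal.ofReal (t ^ p) *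
            μ {ω | ENNReal.ofReal t <
              ⨆ (n : ℕ) (_ : m ≤ n),
                ENNReal.ofReal (1 / (n : ℝ) ^ ((m : ℝ) / p) * ‖uStat h ξ n ω‖)}
          ≤ ENNReal.ofReal K * ∫⁻ ω, ‖kernelRV h ξ ω‖ₑ ^ p ∂μ) ∧
        (∫⁻ ω, ‖kernelRV h ξ ω‖ₑ ^ p ∂μ < ⊤ →
          ∀ᵐ ω ∂μ, Tendsto
            (fun n : ℕ => 1 / (n : ℝ) ^ ((m : ℝ) / p) * ‖uStat h ξ n ω‖) atTop (𝓝 0)) := by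
  obtain ⟨φ, κ, C, hφ⟩ := hB.exists_isSmoothGauge (hp₁.trans hpr).le hr₂
  have hK := tailConstant_ne_top hp₁ hpr κ C
  refine ⟨(tailConstant p r κ C).toReal + 1, by positivity,
    fun m hm Ω _ μ _ S _ ξ h hξ hh hdeg => ?_⟩
  have ha : 0 ≤ (m : ℝ) / p := by positivity
  have htails {t : ENNReal} := hφ.rpow_mul_tsum_measure_le_of_isDegenerated hξ hh hdeg hp₁ hpr hm
    (t := t)
  refine ⟨iSup₂_le fun t ht => ?_, fun hfin => ?_⟩
  · have hK_le : tailConstant p r κ C ≤ ENNReal.ofReal ((tailConstant p r κ C).toReal + 1) :=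
      (ENNReal.le_ofReal_iff_toReal_le hK (by positivity)).2 (lt_add_one _).le
    rw [← ENNReal.ofReal_rpow_of_pos ht]
    calc _ ≤ _ := mul_le_mul_right (measure_lt_iSup_one_div_rpow_mul_norm_le_tsum ha hm _) _
      _ ≤ _ := htails (by simpa using ht) ENNReal.ofReal_ne_top
      _ ≤ _ := mul_le_mul_left hK_le _
  · refine ae_tendsto_one_div_rpow_mul_norm_zero ha fun t ht₀ ht => ?_
    have htp : t ^ p ≠ 0 := by simp [ht₀, ht]
    exact fun htop => ((htails ht₀ ht).trans_lt (ENNReal.mul_lt_top hK.lt_top hfin)).ne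
      (by rw [htop, ENNReal.mul_top htp])

theorem mainTheorem5 {B : Type*} [NormedAddCommGroup B] [NormedSpace ℝ B] [CompleteSpace B]
    [TopologicalSpace.SeparableSpace B] [MeasurableSpace B] [BorelSpace B]
    (r : ℝ) (hr₁ : 1 < r) (hr₂ : r ≤ 2) (hB : IsRSmooth B r)
    (p : ℝ) (hp₁ : 1 < p) (hpr : p < r) :
    ∃ K : ℝ, 0 < K ∧
      ∀ (m : ℕ), 2 ≤ m →
      ∀ (Ω : Type*) [MeasurableSpace Ω] (μ : Measure Ω) [IsProbabilityMeasure μ]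
        (S : Type*) [MeasurableSpace S]
        (ξ : ℕ → Ω → S) (h : (Fin m → S) → B),
        IsIIDSequence ξ μ → Measurable h → IsDegenerated h ξ μ →
        (⨆ (t : ℝ) (_ : 0 < t), ENNReal.ofReal (t ^ p) *
            μ {ω | ENNReal.ofReal t <
              ⨆ (n : ℕ) (_ : m ≤ n),
                ENNReal.ofReal (1 / (n : ℝ) ^ ((m : ℝ) / p) * ‖uStat h ξ n ω‖)}
          ≤ ENNReal.ofReal K * ∫⁻ ω, ‖kernelRV h ξ ω‖ₑ ^ p ∂μ) ∧
        (∫⁻ ω, ‖kernelRV h ξ ω‖ₑ ^ p ∂μ < ⊤ →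
          ∀ᵐ ω ∂μ, Tendsto
            (fun n : ℕ => 1 / (n : ℝ) ^ ((m : ℝ) / p) * ‖uStat h ξ n ω‖) atTop (𝓝 0)) := by
  have : SecondCountableTopology B := UniformSpace.secondCountable_of_separable B
  obtain ⟨K, hK, H⟩ := mainTheorem5_general r hr₂ hB p hp₁ hpr
  exact ⟨K, hK, fun m hm Ω _ μ _ S _ ξ h hξ hh =>
    H m (one_le_two.trans hm) Ω μ S ξ h hξ hh.stronglyMeasurable⟩
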